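/- **Setting.** There are $K$ sources; for each $n\in\mathbb N=\{1,2,\dots\}$ source $k$ generates at time $n$ a random element $X_n^k$ of a measurable space, and $X_n=(X_n^1,\dots,X_n^K)$. For $E\subseteq[K]$ let $X_n^E=(X_n^k)_{k\in E}$, and for a distribution $\mathsf P$ of $X_n$ let $\mathsf P^E$ be the induced distribution of $X_n^E$. Let $\mathsf F$ be the pre-change distribution and $\mathcal G$ a family of possible post-change distributions. For $\nu\in\{0,1,\dots\}$ and $\mathsf G\in\mathcal G$, under $\mathbb P_\nu^{\mathsf G}$ the vectors $X_1,X_2,\dots$ are independent, $X_n\sim\mathsf F$ for $n\le\nu$ and $X_n\sim\mathsf G$ for $n>\nu$. Fix $m$, let $\mathcal K_m$ be the family of subsets of $[K]$ of size $m$, and let $\mathcal A(\mathsf G)=\{E\in\mathcal K_m:\mathsf G^E\ne\mathsf F^E\}$. Assume that for every $\mathsf G\in\mathcal G$ and $E\in\mathcal A(\mathsf G)$ the distributions $\mathsf G^E$ and $\mathsf F^E$ are mutually absolutely continuous. Let $\mathcal U\subseteq\mathcal K_m$ be a non-empty family of *units* such that for each $E\in\mathcal U$ the set $\mathcal G^E=\{\mathsf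 G^E:\mathsf G\in\mathcal G,\ \mathsf G^E\ne\mathsf F^E\}$ is non-empty and finite. Put $$\mathsf H^E=\frac1{|\mathcal G^E|}\sum_{\mathsf P\in\mathcal G^E}\mathsf P,\qquad \xi_n^E=\log\frac{d\mathsf H^E}{d\mathsf F^E}(X_n^E).$$ **Policy.** Fix an ordering $E_1,\dots,E_{|\mathcal U|}$ of $\mathcal U$ and a threshold $A>0$. The Round Robin CUSUM policy $(\tilde S,\tilde T)$ samples $\tilde S_1=E_1$, sets $Y_0=0$ and $Y_n=\max\{Y_{n-1},0\}+\xi_n^{\tilde S_n}$; if $Y_n\in(0,A)$ then $\tilde S_{n+1}=\tilde S_n$; if $Y_n\le0$ then $\tilde S_{n+1}$ is the unit that follows $\tilde S_n$ in the ordering (cyclically, $E_1$ following $E_{|\mathcal U|}$); and it stops at $\tilde T=\inf\{n\in\mathbb N:Y_n\ge A\}$. **Delay.** For a policy $(S,T)$ let $$D^{\mathsf G}(S,T)=\sup_{\nu\ge0}\ \operatorname{ess\,sup}\ \mathbb E_\nu^{\mathsf G}\big[T-\nu\,\big|\,\mathcal F_\nu^S(\mathsf G),\,T>\nu\big],\qquad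 \mathcal F_\nu^S(\mathsf G)=\sigma\big(S_t,X_t^{S_t}:\ 1\le t\le\nu,\ S_t\in\mathcal A(\mathsf G)\big).$$ **Theorem.** Let $\mathsf G\in\mathcal G$ be such that $\mathcal A(\mathsf G)\cap\mathcal U\neq\emptyset$, $$\mathcal J_\infty^E:=\int\log\frac{d\mathsf F^E}{d\mathsf H^E}\,d\mathsf F^E\in(0,\infty)\quad\text{for every }E\in\mathcal U,$$ $$\mathcal J_0^E(\mathsf G):=\int\log\frac{d\mathsf H^E}{d\mathsf F^E}\,d\mathsf G^E\in(0,\infty)\quad\text{for every }E\in\mathcal A(\mathsf G)\cap\mathcal U.$$ Then, as $A\to\infty$, $$D^{\mathsf G}(\tilde S,\tilde T)\ \le\ \max_{E\in\mathcal A(\mathsf G)\cap\mathcal U}\frac{A}{\mathcal J_0^E(\mathsf G)}+o(A).$$ -/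

import Mathlib

open MeasureTheory ProbabilityTheory Filter Asymptotics
open scoped ENNReal

noncomputable section

namespace RoundRobin

/-! `K` sources; source `k` takes values in a measurable space `𝒳 k`. A global distribution is
a probability measure on `∀ k, 𝒳 k`; a sample path is `ω : ℕ → ∀ k, 𝒳 k`.
Coordinates of paths and of sampling rules are counted from `0`: `ω n` is the vector generated at
time `n + 1`, and `S n` is the set of sources sampled at time `n + 1`. -/

variable {K : ℕ} {𝒳 : Fin K → Type*} [∀ k, MeasurableSpace (𝒳 k)]

/-- The local distribution `P^E` of the sources in `E` under the global distribution `P`. -/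
def localLaw (P : ProbabilityMeasure (∀ k, 𝒳 k)) (E : Finset (Fin K)) : Measure (∀ k : E, 𝒳 k) :=
  (P : Measure (∀ k, 𝒳 k)).map E.restrict

/-- The law `P_ν^G` of the path when the change happens at time `ν`: independent coordinates, with
global distribution `F` at times `1, …, ν` and `G` afterwards. -/
def changeLaw (F G : ProbabilityMeasure (∀ k, 𝒳 k)) (ν : ℕ) : Measure (ℕ → ∀ k, 𝒳 k) :=
  Measure.infinitePi fun n =>
    ((if n < ν then F else G : ProbabilityMeasure (∀ k, 𝒳 k)) : Measure (∀ k, 𝒳 k))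

open scoped Classical in
/-- `𝒜(G)`: the sets of `m` sources whose local distribution is affected by the change. -/
def affected (m : ℕ) (F G : ProbabilityMeasure (∀ k, 𝒳 k)) : Finset (Finset (Fin K)) :=
  (Finset.powersetCard m Finset.univ).filter fun E => localLaw G E ≠ localLaw F E

/-- `𝒢^E`: the plausible post-change local distributions of `E`. -/
def localFamily (𝒢 : Set (ProbabilityMeasure (∀ k, 𝒳 k))) (F : ProbabilityMeasure (∀ k, 𝒳 k))
    (E : Finset (Fin K)) : Set (Measure (∀ k : E, 𝒳 k)) :=
  {Q | (∃ G ∈ 𝒢, Q = localLaw G E) ∧ Q ≠ localLaw F E}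

/-- `H^E`: the uniform mixture of the (finitely many) members of `𝒢^E`. -/
def mixture (𝒢 : Set (ProbabilityMeasure (∀ k, 𝒳 k))) (F : ProbabilityMeasure (∀ k, 𝒳 k))
    (E : Finset (Fin K)) : Measure (∀ k : E, 𝒳 k) :=
  ((localFamily 𝒢 F E).ncard : ℝ≥0∞)⁻¹ • Measure.sum fun Q : localFamily 𝒢 F E => Q.1

/-- The log-likelihood ratio `ξ^E = log (dH^E / dF^E)`, as a function of the sample from `E`. -/
def xi (𝒢 : Set (ProbabilityMeasure (∀ k, 𝒳 k))) (F : ProbabilityMeasure (∀ k, 𝒳 k))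
    (E : Finset (Fin K)) : (∀ k : E, 𝒳 k) → ℝ :=
  llr (mixture 𝒢 F E) (localLaw F E)

/-- `J_∞^E = ∫ log (dF^E / dH^E) dF^E`, minus the pre-change drift of `ξ^E`. -/
def driftPre (𝒢 : Set (ProbabilityMeasure (∀ k, 𝒳 k))) (F : ProbabilityMeasure (∀ k, 𝒳 k))
    (E : Finset (Fin K)) : ℝ :=
  ∫ x, llr (localLaw F E) (mixture 𝒢 F E) x ∂(localLaw F E)

/-- `J_0^E(G) = ∫ log (dH^E / dF^E) dG^E`, the post-change drift of `ξ^E`. -/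
def driftPost (𝒢 : Set (ProbabilityMeasure (∀ k, 𝒳 k))) (F G : ProbabilityMeasure (∀ k, 𝒳 k))
    (E : Finset (Fin K)) : ℝ :=
  ∫ x, xi 𝒢 F E x ∂(localLaw G E)

/-! ### Detection delay of a policy `(S, T)` -/

/-- `ℱ_ν^S(G) = σ(S_t, X_t^{S_t} : t ≤ ν, S_t ∈ 𝒜(G))`, generated by the events
`{S_t = E, X_t^E ∈ B}` with `t ≤ ν` and `E ∈ 𝒜(G)`. -/
abbrev history (m : ℕ) (F G : ProbabilityMeasure (∀ k, 𝒳 k))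
    (S : ℕ → (ℕ → ∀ k, 𝒳 k) → Finset (Fin K)) (ν : ℕ) : MeasurableSpace (ℕ → ∀ k, 𝒳 k) :=
  MeasurableSpace.generateFrom
    {s | ∃ t < ν, ∃ E ∈ affected m F G, ∃ B : Set (∀ k : E, 𝒳 k), MeasurableSet B ∧
      s = {ω | S t ω = E ∧ E.restrict (ω t) ∈ B}}

/-- `D^G(S,T) = sup_ν ess sup E_ν^G[T - ν | ℱ_ν^S(G), T > ν]`, with values in `[0, ∞]`: the
conditional expectation and the essential supremum are those of `P_ν^G( · | T > ν)`. -/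
def worstDelay (m : ℕ) (F G : ProbabilityMeasure (∀ k, 𝒳 k))
    (S : ℕ → (ℕ → ∀ k, 𝒳 k) → Finset (Fin K)) (T : (ℕ → ∀ k, 𝒳 k) → ℕ∞) : ℝ≥0∞ :=
  ⨆ ν : ℕ,
    essSup
      (condLExp (history m F G S ν) (cond (changeLaw F G ν) {ω | (ν : ℕ∞) < T ω})
        fun ω => ((T ω - (ν : ℕ∞) : ℕ∞) : ℝ≥0∞))
      (cond (changeLaw F G ν) {ω | (ν : ℕ∞) < T ω})

/-! ### The Round Robin CUSUM policy
The units are listed as `e 0, …, e (L - 1)`; addition in `Fin L` is cyclic. -/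

variable {U : Finset (Finset (Fin K))} {L : ℕ} [NeZero L]

/-- One step of the policy. The current state is (`Y_{n-1}`, position of the unit sampled at time
`n`) and `x = X_n`. The new state has `Y_n = max (Y_{n-1}) 0 + ξ_n`, and the next unit in the list
is taken exactly when `Y_n ≤ 0`. -/
def step (𝒢 : Set (ProbabilityMeasure (∀ k, 𝒳 k))) (F : ProbabilityMeasure (∀ k, 𝒳 k))
    (e : Fin L ≃ U) (x : ∀ k, 𝒳 k) (s : ℝ × Fin L) : ℝ × Fin L :=
  let E : Finset (Fin K) := (e s.2).1
  let Y : ℝ := max s.1 0 + xi 𝒢 F E (E.restrict x)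
  (Y, if Y ≤ 0 then s.2 + 1 else s.2)

/-- The pair (`Y_n`, position in the list of the unit that is sampled at time `n + 1`). -/
def state (𝒢 : Set (ProbabilityMeasure (∀ k, 𝒳 k))) (F : ProbabilityMeasure (∀ k, 𝒳 k))
    (e : Fin L ≃ U) (ω : ℕ → ∀ k, 𝒳 k) : ℕ → ℝ × Fin L
  | 0 => (0, 0)
  | n + 1 => step 𝒢 F e (ω n) (state 𝒢 F e ω n)

/-- The sampling rule (`rule n` is the unit sampled at time `n + 1`). What it does after the alarm
is immaterial. -/
def rule (𝒢 : Set (ProbabilityMeasure (∀ k, 𝒳 k))) (F : ProbabilityMeasure (∀ k, 𝒳 k))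
    (e : Fin L ≃ U) (n : ℕ) (ω : ℕ → ∀ k, 𝒳 k) : Finset (Fin K) :=
  (e (state 𝒢 F e ω n).2).1

/-- The alarm time `inf {n ≥ 1 : Y_n ≥ A}`, equal to `⊤` when no alarm is ever raised. -/
def alarm (𝒢 : Set (ProbabilityMeasure (∀ k, 𝒳 k))) (F : ProbabilityMeasure (∀ k, 𝒳 k))
    (e : Fin L ≃ U) (A : ℝ) (ω : ℕ → ∀ k, 𝒳 k) : ℕ∞ :=
  ⨅ n ∈ {n : ℕ | 1 ≤ n ∧ A ≤ (state 𝒢 F e ω n).1}, (n : ℕ∞)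

end RoundRobin

end

open RoundRobin

/-! After the change the pair (statistic, current unit) is a Markov chain, and its mean time to
alarm from any state is bounded by every supersolution `h`, a function with 1 + E[h(next state); no
alarm] ≤ h (`lintegral_alarm_sub_le`). The function `timeBound` is one. On an affected unit at
height y it is about (A - y)/J plus κ exp(-ℓ y), which pays for a fall to zero followed by a passage
through unaffected units. On an unaffected unit it also contains y⁺/J₁, the time in which a negative
drift removes y. Hence h is at most A/J + O(1) on affected units and A/J + O(1) + C y⁺ on unaffected
ones (`exists_time_supersolution`).

The difficulty is the term C y⁺: the change may find the policy on an unaffected unit with a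
statistic of order A, so a pathwise bound loses a multiple of A. The delay, however, conditions only
on data from affected units. Split according to the last time s ≤ ν at which the statistic was
non-positive. If the unit taken up then is unaffected, the history up to ν is, on this event,
determined by the first s vectors (`exists_past_inter_excursion`). Given those, the statistic at ν
is a random walk from 0 conditioned to have stayed in (0, A) for ν - s steps
(`lintegral_excursion`). It remains to show that this conditional mean is o(A), uniformly in the
number of steps (`stripStep_iterate_ofReal_le`).

The increments satisfy E exp X = 1 and E X < 0, so the moment generating function has a critical
point θ in (0, 1), with value ρ. Since exp(θ y) is an eigenfunction of the unkilled walk with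
eigenvalue ρ, endpoints above εA/2 contribute at most A ρⁿ exp(θ y - θεA/2). The survival
probability is at least ρⁿ exp(θ y - δA) by explicit steering (`exists_ofReal_le_survival`): forced
steps away from the boundary, a descent under a tilt slightly below θ, then hovering under θ, with
Kolmogorov's inequality controlling the fluctuations. This lower bound is needed from every start in
the strip at a single time j only, and from 0 at times n ≤ j. For later times the comparison at j is
propagated by the positivity of the killed transition operator. -/

namespace RoundRobin

/-! ### The killed random walk as a positive operator -/

/-- One step of the random walk with increment law `μ`, killed outside `(0, A)`. -/
noncomputable def stripStep (μ : Measure ℝ) (A : ℝ) (f : ℝ → ℝ≥0∞) (y : ℝ) : ℝ≥0∞ :=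
  ∫⁻ x, (Set.Ioo 0 A).indicator f (y + x) ∂μ

section stripStep

variable {μ : Measure ℝ} {A : ℝ}

lemma stripStep_mono {f g : ℝ → ℝ≥0∞} (h : ∀ w ∈ Set.Ioo 0 A, f w ≤ g w) (y : ℝ) :
    stripStep μ A f y ≤ stripStep μ A g y := by
  refine lintegral_mono fun x => ?_
  by_cases hx : y + x ∈ Set.Ioo 0 A
  · simpa [Set.indicator_of_mem hx] using h _ hx
  · simp [Set.indicator_of_notMem hx]

lemma stripStep_iterate_mono {f g : ℝ → ℝ≥0∞} (h : ∀ w ∈ Set.Ioo 0 A, f w ≤ g w) (n : ℕ) {y : ℝ}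
    (hy : f y ≤ g y) : (stripStep μ A)^[n] f y ≤ (stripStep μ A)^[n] g y := by
  induction n generalizing y with
  | zero => exact hy
  | succ n ih =>
    rw [Function.iterate_succ_apply', Function.iterate_succ_apply']
    exact stripStep_mono (fun w hw => ih (h w hw)) y

/-- After one step the surviving walk is inside the strip, so the comparison is needed only there,
even for the start 0, which lies outside. -/
lemma stripStep_iterate_succ_mono {f g : ℝ → ℝ≥0∞} (h : ∀ w ∈ Set.Ioo 0 A, f w ≤ g w) (n : ℕ)
    (y : ℝ) : (stripStep μ A)^[n + 1] f y ≤ (stripStep μ A)^[n + 1] g y := by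
  rw [Function.iterate_succ_apply', Function.iterate_succ_apply']
  exact stripStep_mono (fun w hw => stripStep_iterate_mono h n (h w hw)) y

lemma stripStep_const_mul {c : ℝ≥0∞} (hc : c ≠ ∞) (f : ℝ → ℝ≥0∞) :
    stripStep μ A (fun w => c * f w) = fun y => c * stripStep μ A f y := by
  ext y
  rw [stripStep, stripStep, ← lintegral_const_mul' _ _ hc]
  refine lintegral_congr fun x => ?_
  by_cases hx : y + x ∈ Set.Ioo 0 A
  · simp [Set.indicator_of_mem hx]
  · simp [Set.indicator_of_notMem hx]

lemma stripStep_iterate_const_mul {c : ℝ≥0∞} (hc : c ≠ ∞) (f : ℝ → ℝ≥0∞) (n : ℕ) :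
    (stripStep μ A)^[n] (fun w => c * f w) = fun y => c * (stripStep μ A)^[n] f y := by
  induction n with
  | zero => rfl
  | succ n ih =>
    rw [Function.iterate_succ_apply', Function.iterate_succ_apply', ih, stripStep_const_mul hc]

/-- Survival through `N` steps whose sizes are all forced to lie in `[a, b]`. -/
lemma pow_mul_le_stripStep_iterate {a b : ℝ} {p c : ℝ≥0∞} (hp : p ≤ μ (Set.Icc a b))
    {f : ℝ → ℝ≥0∞} (N : ℕ) (y : ℝ)
    (hD : ∀ k : ℕ, 1 ≤ k → k ≤ N → Set.Icc (y + k * a) (y + k * b) ⊆ Set.Ioo 0 A)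
    (hf : ∀ w ∈ Set.Icc (y + N * a) (y + N * b), c ≤ f w) :
    p ^ N * c ≤ (stripStep μ A)^[N] f y := by
  induction N generalizing y with
  | zero => simpa using hf y
  | succ N ih =>
    rw [Function.iterate_succ_apply']
    calc p ^ (N + 1) * c ≤ ∫⁻ _ in Set.Icc a b, p ^ N * c ∂μ := by
          rw [setLIntegral_const, pow_succ]
          calc p ^ N * p * c = p ^ N * c * p := by ring
            _ ≤ _ := by gcongr
      _ ≤ ∫⁻ x in Set.Icc a b, (Set.Ioo 0 A).indicator ((stripStep μ A)^[N] f) (y + x) ∂μ := by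
          refine setLIntegral_mono' measurableSet_Icc fun x hx => ?_
          have h1 : y + x ∈ Set.Ioo 0 A := hD 1 le_rfl (by omega) (by
            constructor <;> simp [hx.1, hx.2])
          rw [Set.indicator_of_mem h1]
          refine ih (y + x) (fun k hk hkN => ?_) (fun w hw => hf w ?_)
          · refine subset_trans ?_ (hD (k + 1) (by omega) (by omega))
            push_cast
            exact Set.Icc_subset_Icc (by linarith [hx.1]) (by linarith [hx.2])
          · push_cast
            exact ⟨by linarith [hx.1, hw.1], by linarith [hx.2, hw.2]⟩
      _ ≤ _ := setLIntegral_le_lintegral _ _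

end stripStep

/-! ### Exponential tilting and Kolmogorov's inequality -/

/-- `φ` is the total mass, `m` the mean and `v` the variance of the measure `e^{θ x} μ(dx)`
(the latter two after normalization). -/
structure HasTilt (μ : Measure ℝ) (θ φ m v : ℝ) : Prop where
  pos : 0 < φ
  int_zero : Integrable (fun x => Real.exp (θ * x)) μ
  int_one : Integrable (fun x => x * Real.exp (θ * x)) μ
  int_two : Integrable (fun x => x ^ 2 * Real.exp (θ * x)) μ
  mass : ∫ x, Real.exp (θ * x) ∂μ = φ
  mean : ∫ x, x * Real.exp (θ * x) ∂μ = m * φ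
  var : ∫ x, (x - m) ^ 2 * Real.exp (θ * x) ∂μ = v * φ

section Tilt

variable {μ : Measure ℝ} {A θ φ m v : ℝ}

/-- Centring at the tilted mean kills the linear term. This is the exact one-step computation behind
Kolmogorov's inequality. -/
lemma HasTilt.integral_quadratic (h : HasTilt μ θ φ m v) (α β γ : ℝ) :
    Integrable (fun x => (α + β * (x - m) + γ * (x - m) ^ 2) * Real.exp (θ * x)) μ ∧
      ∫ x, (α + β * (x - m) + γ * (x - m) ^ 2) * Real.exp (θ * x) ∂μ = (α + γ * v) * φ := by
  have i1 : Integrable (fun x => (x - m) * Real.exp (θ * x)) μ :=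
    (h.int_one.sub (h.int_zero.const_mul m)).congr (.of_forall fun x => by simp; ring)
  have e1 : ∫ x, (x - m) * Real.exp (θ * x) ∂μ = 0 := by
    have : ∀ x, (x - m) * Real.exp (θ * x) = x * Real.exp (θ * x) - m * Real.exp (θ * x) :=
      fun x => by ring
    simp_rw [this]
    rw [integral_sub h.int_one (h.int_zero.const_mul m), integral_const_mul, h.mass, h.mean, sub_self]
  have i2 : Integrable (fun x => (x - m) ^ 2 * Real.exp (θ * x)) μ :=
    ((h.int_two.sub (h.int_one.const_mul (2 * m))).add (h.int_zero.const_mul (m ^ 2))).congr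
      (.of_forall fun x => by simp; ring)
  have hx : ∀ x, (α + β * (x - m) + γ * (x - m) ^ 2) * Real.exp (θ * x) =
      (α * Real.exp (θ * x) + β * ((x - m) * Real.exp (θ * x))) +
        γ * ((x - m) ^ 2 * Real.exp (θ * x)) := fun x => by ring
  simp_rw [hx]
  have ia : Integrable (fun x => α * Real.exp (θ * x) + β * ((x - m) * Real.exp (θ * x))) μ :=
    (h.int_zero.const_mul α).add (i1.const_mul β)
  refine ⟨ia.add (i2.const_mul γ), ?_⟩
  rw [integral_add ia (i2.const_mul γ), integral_add (h.int_zero.const_mul α) (i1.const_mul β),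
    integral_const_mul, integral_const_mul, integral_const_mul, e1, h.mass, h.var]
  ring

/-- Survival probability of the walk along the line of slope `m` started at `z`, within distance
`r` of that line: Kolmogorov's inequality for the tilted walk. -/
lemma HasTilt.le_stripStep_iterate (h : HasTilt μ θ φ m v) (hθ : 0 ≤ θ) (hv : 0 ≤ v) {r : ℝ}
    (hr : 0 < r) {c : ℝ≥0∞} {f : ℝ → ℝ≥0∞} (t : ℕ) (y z : ℝ)
    (hD : ∀ s : ℕ, s ≤ t → Set.Ioo (z + m * s - r) (z + m * s + r) ⊆ Set.Ioo 0 A)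
    (hf : ∀ w ∈ Set.Ioo (z + m * t - r) (z + m * t + r), c ≤ f w) :
    c * ENNReal.ofReal (φ ^ t * Real.exp (θ * (y - z - m * t - r)) *
      (1 - ((y - z) ^ 2 + t * v) / r ^ 2)) ≤ (stripStep μ A)^[t] f y := by
  have hr2 : 0 < r ^ 2 := by positivity
  -- Outside the tube the quadratic factor is non-positive, so the claimed lower bound is void there
  -- and killing the walk costs nothing.
  have out : ∀ (t : ℕ) (y z : ℝ), y ∉ Set.Ioo (z - r) (z + r) →
      φ ^ t * Real.exp (θ * (y - z - m * t - r)) * (1 - ((y - z) ^ 2 + t * v) / r ^ 2) ≤ 0 := by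
    intro t y z hy
    refine mul_nonpos_of_nonneg_of_nonpos (mul_nonneg (pow_nonneg h.pos.le _) (Real.exp_pos _).le) ?_
    rw [sub_nonpos, one_le_div hr2]
    have : r ^ 2 ≤ (y - z) ^ 2 := by
      rw [Set.mem_Ioo, not_and_or, not_lt, not_lt] at hy
      rcases hy with hy | hy <;> nlinarith
    have : 0 ≤ t * v := by positivity
    linarith
  induction t generalizing y z with
  | zero =>
    by_cases hy : y ∈ Set.Ioo (z - r) (z + r)
    · simp only [Function.iterate_zero, id]
      refine le_trans ?_ (hf y (by simpa using hy))
      refine mul_le_of_le_one_right' (ENNReal.ofReal_le_one.2 ?_)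
      have h1 : Real.exp (θ * (y - z - m * (0 : ℕ) - r)) ≤ 1 := by
        rw [Real.exp_le_one_iff]
        have := hy.2
        exact mul_nonpos_of_nonneg_of_nonpos hθ (by push_cast; linarith)
      have h2 : 1 - ((y - z) ^ 2 + (0 : ℕ) * v) / r ^ 2 ≤ 1 := by
        have : 0 ≤ ((y - z) ^ 2 + (0 : ℕ) * v) / r ^ 2 := by positivity
        linarith
      calc _ ≤ φ ^ 0 * Real.exp (θ * (y - z - m * (0 : ℕ) - r)) * 1 :=
            mul_le_mul_of_nonneg_left h2 (by positivity)
        _ ≤ 1 := by simpa using h1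
    · rw [ENNReal.ofReal_of_nonpos (out 0 y z hy)]
      simp
  | succ t ih =>
    rw [Function.iterate_succ_apply']
    set g : ℝ → ℝ := fun w => φ ^ t * Real.exp (θ * (w - (z + m) - m * t - r)) *
      (1 - ((w - (z + m)) ^ 2 + t * v) / r ^ 2) with hg
    have hpt : ∀ x, c * ENNReal.ofReal (g (y + x)) ≤
        (Set.Ioo 0 A).indicator ((stripStep μ A)^[t] f) (y + x) := by
      intro x
      by_cases hx : y + x ∈ Set.Ioo 0 A
      · rw [Set.indicator_of_mem hx]
        refine ih (y + x) (z + m) (fun s hs => ?_) (fun w hw => hf w ?_)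
        · have := hD (s + 1) (by omega)
          push_cast at this
          convert this using 2 <;> ring
        · push_cast
          convert hw using 2 <;> ring
      · have : y + x ∉ Set.Ioo (z + m - r) (z + m + r) := fun hh => hx (hD 1 (by omega) (by
          simpa using hh))
        rw [ENNReal.ofReal_of_nonpos (out t _ _ this)]
        simp
    have hq := h.integral_quadratic
      (φ ^ t * Real.exp (θ * (y - z - m - m * t - r)) * (1 - ((y - z) ^ 2 + t * v) / r ^ 2))
      (φ ^ t * Real.exp (θ * (y - z - m - m * t - r)) * (-(2 * (y - z)) / r ^ 2))
      (φ ^ t * Real.exp (θ * (y - z - m - m * t - r)) * (-1 / r ^ 2))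
    have hgx : (fun x => (φ ^ t * Real.exp (θ * (y - z - m - m * t - r)) *
        (1 - ((y - z) ^ 2 + t * v) / r ^ 2) +
        φ ^ t * Real.exp (θ * (y - z - m - m * t - r)) * (-(2 * (y - z)) / r ^ 2) * (x - m) +
        φ ^ t * Real.exp (θ * (y - z - m - m * t - r)) * (-1 / r ^ 2) * (x - m) ^ 2) *
        Real.exp (θ * x)) = fun x => g (y + x) := by
      funext x
      have : Real.exp (θ * (y + x - (z + m) - m * t - r)) =
          Real.exp (θ * (y - z - m - m * t - r)) * Real.exp (θ * x) := by
        rw [← Real.exp_add]; congr 1; ring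
      simp only [hg, this]
      field_simp
      ring
    rw [hgx] at hq
    -- Averaging the bound for `t` over one tilted step reproduces the bound for `t + 1` exactly:
    -- the mass supplies a factor `φ` and the variance of the step supplies one more `v`.
    have hint : ∫ x, g (y + x) ∂μ = φ ^ (t + 1) *
        Real.exp (θ * (y - z - m * (t + 1 : ℕ) - r)) *
        (1 - ((y - z) ^ 2 + (t + 1 : ℕ) * v) / r ^ 2) := by
      rw [hq.2]
      have : y - z - m * ((t + 1 : ℕ) : ℝ) - r = y - z - m - m * t - r := by push_cast; ring
      rw [this]
      push_cast
      field_simp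
      ring
    calc c * ENNReal.ofReal (φ ^ (t + 1) * Real.exp (θ * (y - z - m * (t + 1 : ℕ) - r)) *
          (1 - ((y - z) ^ 2 + (t + 1 : ℕ) * v) / r ^ 2))
        = c * ENNReal.ofReal (∫ x, g (y + x) ∂μ) := by rw [hint]
      _ ≤ c * ∫⁻ x, ENNReal.ofReal (g (y + x)) ∂μ := by
          gcongr
          have h1 : ∫ x, g (y + x) ∂μ ≤ ∫ x, max (g (y + x)) 0 ∂μ :=
            integral_mono hq.1 hq.1.pos_part fun x => le_max_left _ _
          refine (ENNReal.ofReal_le_ofReal h1).trans ?_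
          rw [ofReal_integral_eq_lintegral_ofReal hq.1.pos_part
            (.of_forall fun x => le_max_right _ _)]
          refine le_of_eq (lintegral_congr fun x => ?_)
          simp [ENNReal.ofReal_max]
      _ = ∫⁻ x, c * ENNReal.ofReal (g (y + x)) ∂μ := by
          rw [lintegral_const_mul]
          simp only [hg]
          fun_prop
      _ ≤ _ := lintegral_mono hpt

end Tilt

/-! ### Tilts and step sizes of a law with E exp X = 1 and E X < 0 -/

section ExistsTilt

variable {μ : Measure ℝ}

lemma hasTilt_of_mem_interior {θ : ℝ} [NeZero μ]
    (hθ : θ ∈ interior (integrableExpSet id μ)) :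
    ∃ v, 0 ≤ v ∧ HasTilt μ θ (mgf id μ θ) (deriv (mgf id μ) θ / mgf id μ θ) v := by
  have hi : Integrable (fun x => Real.exp (θ * x)) μ :=
    integrable_of_mem_integrableExpSet (interior_subset hθ)
  have hpos : 0 < mgf id μ θ := mgf_pos' (NeZero.ne μ) hi
  have hk := integrable_pow_mul_exp_of_mem_interior_integrableExpSet hθ
  refine ⟨(∫ x, (x - deriv (mgf id μ) θ / mgf id μ θ) ^ 2 * Real.exp (θ * x) ∂μ) / mgf id μ θ,
    div_nonneg (integral_nonneg fun x => by positivity) hpos.le, hpos, hi, ?_, ?_, rfl, ?_, ?_⟩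
  · simpa using hk 1
  · simpa using hk 2
  · rw [div_mul_cancel₀ _ hpos.ne', deriv_mgf hθ]; rfl
  · rw [div_mul_cancel₀ _ hpos.ne']

lemma not_ae_eq_zero_of_integral_neg (hneg : ∫ x, x ∂μ < 0) : ¬ ∀ᵐ x ∂μ, x = 0 := by
  intro h
  rw [integral_congr_ae (g := fun _ => 0) h] at hneg
  simp at hneg

variable [IsProbabilityMeasure μ]

/-- The moment generating function M equals 1 at 0 and at 1 and is smaller at 1/2, so M' changes
sign in between. At the first zero θ of M' past a point of negative slope the tilted walk is
centred. Just below θ the tilted drift is negative while M is at least ρ = M(θ), so tilting there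
loses no mass. -/
lemma exists_hasTilt (hexp : Integrable Real.exp μ) (hone : ∫ x, Real.exp x ∂μ = 1)
    (hneg : ∫ x, x ∂μ < 0) :
    ∃ θ ρ v, 0 < θ ∧ θ < 1 ∧ ρ ≤ 1 ∧ 0 ≤ v ∧ HasTilt μ θ ρ 0 v ∧ ∀ κ > 0, ∃ θ₁ φ₁ η v₁,
      0 < θ₁ ∧ θ₁ < θ ∧ θ - θ₁ ≤ κ ∧ 0 < η ∧ 0 ≤ v₁ ∧ ρ ≤ φ₁ ∧ HasTilt μ θ₁ φ₁ (-η) v₁ := by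
  have hle : ∀ θ ∈ Set.Icc (0 : ℝ) 1, ∀ x, Real.exp (θ * x) ≤ (1 - θ) + θ * Real.exp x := by
    intro θ hθ x
    have := convexOn_exp.2 (Set.mem_univ 0) (Set.mem_univ x) (sub_nonneg.2 hθ.2) hθ.1 (by ring)
    simpa using this
  have hbd : Integrable (fun x => 1 + Real.exp x) μ := (integrable_const 1).add hexp
  have hle' : ∀ θ ∈ Set.Icc (0 : ℝ) 1, ∀ x, Real.exp (θ * x) ≤ 1 + Real.exp x := by
    intro θ hθ x
    have := hle θ hθ x
    nlinarith [Real.exp_pos x, hθ.1, hθ.2]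
  have hint : ∀ θ ∈ Set.Icc (0 : ℝ) 1, Integrable (fun x => Real.exp (θ * x)) μ := by
    intro θ hθ
    refine hbd.mono' (by fun_prop) (.of_forall fun x => ?_)
    rw [Real.norm_eq_abs, Real.abs_exp]
    exact hle' θ hθ x
  have hin : Set.Ioo (0 : ℝ) 1 ⊆ interior (integrableExpSet id μ) :=
    interior_maximal (fun θ hθ => hint θ (Set.Ioo_subset_Icc_self hθ)) isOpen_Ioo
  set M := mgf id μ with hM
  have hcont : ContinuousOn M (Set.Icc 0 1) := by
    refine continuousOn_of_dominated (bound := fun x => 1 + Real.exp x)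
      (fun θ _ => by fun_prop) (fun θ hθ => .of_forall fun x => ?_) hbd
      (.of_forall fun x => by fun_prop)
    rw [Real.norm_eq_abs, Real.abs_exp]
    exact hle' θ hθ x
  have hM0 : M 0 = 1 := by simp [hM]
  have hM1 : M 1 = 1 := by simpa [hM, mgf] using hone
  have hMle : ∀ θ ∈ Set.Icc (0 : ℝ) 1, M θ ≤ 1 := by
    intro θ hθ
    calc M θ ≤ ∫ x, ((1 - θ) + θ * Real.exp x) ∂μ :=
          integral_mono (hint θ hθ) ((integrable_const _).add (hexp.const_mul θ)) (hle θ hθ)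
      _ = 1 := by
          rw [integral_add (integrable_const _) (hexp.const_mul θ), integral_const_mul, hone]
          simp
  -- If M(1/2) = 1, then exp(x/2) - 1 has vanishing second moment, so the increment is zero almost
  -- surely, against the negative mean.
  have hhalf : M (1 / 2) < 1 := by
    refine lt_of_le_of_ne (hMle _ (by norm_num)) fun heq => not_ae_eq_zero_of_integral_neg hneg ?_
    have hi := hint (1 / 2) (by norm_num)
    have hz : ∫ x, (1 + Real.exp x - 2 * Real.exp (1 / 2 * x)) ∂μ = 0 := by
      rw [integral_sub hbd (hi.const_mul 2), integral_add (integrable_const 1) hexp,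
        integral_const_mul, hone]
      have : ∫ x, Real.exp (1 / 2 * x) ∂μ = 1 := heq
      rw [this]; norm_num
    have hsq : ∀ x, 1 + Real.exp x - 2 * Real.exp (1 / 2 * x) = (Real.exp (1 / 2 * x) - 1) ^ 2 := by
      intro x
      have : Real.exp x = Real.exp (1 / 2 * x) ^ 2 := by rw [← Real.exp_nat_mul]; congr 1; ring
      rw [this]; ring
    have hd : Integrable (fun x => 1 + Real.exp x - 2 * Real.exp (1 / 2 * x)) μ :=
      hbd.sub (hi.const_mul 2)
    rw [integral_eq_zero_iff_of_nonneg (fun x => (hsq x).symm ▸ sq_nonneg _) hd] at hz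
    filter_upwards [hz] with x hx
    replace hx : 1 + Real.exp x - 2 * Real.exp (1 / 2 * x) = 0 := hx
    rw [hsq] at hx
    have : Real.exp (1 / 2 * x) = 1 := by
      have := pow_eq_zero_iff (two_ne_zero) |>.1 hx
      linarith
    rw [Real.exp_eq_one_iff] at this
    linarith
  have hdiff : ∀ θ ∈ Set.Ioo (0 : ℝ) 1, DifferentiableAt ℝ M θ := fun θ hθ =>
    differentiableAt_mgf (hin hθ)
  obtain ⟨θa, hθa, hda⟩ : ∃ θ ∈ Set.Ioo (0 : ℝ) (1 / 2), deriv M θ = (M (1 / 2) - M 0) / (1 / 2 - 0) :=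
    exists_deriv_eq_slope M (by norm_num)
      (hcont.mono (Set.Icc_subset_Icc le_rfl (by norm_num)))
      (fun θ hθ => (hdiff θ ⟨hθ.1, hθ.2.trans (by norm_num)⟩).differentiableWithinAt)
  obtain ⟨θb, hθb, hdb⟩ : ∃ θ ∈ Set.Ioo (1 / 2 : ℝ) 1, deriv M θ = (M 1 - M (1 / 2)) / (1 - 1 / 2) :=
    exists_deriv_eq_slope M (by norm_num)
      (hcont.mono (Set.Icc_subset_Icc (by norm_num) le_rfl))
      (fun θ hθ => (hdiff θ ⟨lt_trans (by norm_num) hθ.1, hθ.2⟩).differentiableWithinAt)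
  have hda' : deriv M θa < 0 := by
    rw [hda, hM0]
    exact div_neg_of_neg_of_pos (by linarith) (by norm_num)
  have hdb' : 0 < deriv M θb := by
    rw [hdb, hM1]
    exact div_pos (by linarith) (by norm_num)
  have hab : θa < θb := hθa.2.trans hθb.1
  have hsub : Set.Icc θa θb ⊆ Set.Ioo 0 1 := fun x hx =>
    ⟨hθa.1.trans_le hx.1, hx.2.trans_lt hθb.2⟩
  have hdc : ContinuousOn (deriv M) (Set.Icc θa θb) := fun x hx =>
    (analyticAt_mgf (hin (hsub hx))).deriv.continuousAt.continuousWithinAt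
  -- Taking the infimum of the points with M' ≥ 0 makes M' negative on all of [θa, θ), which gives
  -- both the negative drift and the monotonicity required there.
  set Z := Set.Icc θa θb ∩ deriv M ⁻¹' Set.Ici 0 with hZ
  have hZc : IsClosed Z := hdc.preimage_isClosed_of_isClosed isClosed_Icc isClosed_Ici
  have hZb : BddBelow Z := ⟨θa, fun x hx => hx.1.1⟩
  have hθZ : sInf Z ∈ Z := hZc.csInf_mem ⟨θb, ⟨hab.le, le_rfl⟩, hdb'.le⟩ hZb
  set θ := sInf Z with hθ
  have hbelow : ∀ t, θa ≤ t → t < θ → deriv M t < 0 := by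
    intro t h1 h2
    by_contra! h3
    exact (csInf_le hZb ⟨⟨h1, h2.le.trans hθZ.1.2⟩, h3⟩).not_gt h2
  have hlt : θa < θ := by
    refine lt_of_le_of_ne hθZ.1.1 fun h => ?_
    have : 0 ≤ deriv M θ := hθZ.2
    rw [← h] at this
    linarith
  have hzero : deriv M θ = 0 := by
    obtain ⟨t, ht, ht0⟩ := intermediate_value_Icc hlt.le
      (hdc.mono (Set.Icc_subset_Icc le_rfl hθZ.1.2)) ⟨hda'.le, hθZ.2⟩
    rcases ht.2.lt_or_eq with h | h
    · have := hbelow t ht.1 h; linarith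
    · rwa [← h]
  have hanti : AntitoneOn M (Set.Icc θa θ) := by
    have hs : Set.Icc θa θ ⊆ Set.Icc θa θb := Set.Icc_subset_Icc le_rfl hθZ.1.2
    refine antitoneOn_of_deriv_nonpos (convex_Icc _ _)
      (hcont.mono (hs.trans (hsub.trans Set.Ioo_subset_Icc_self)))
      (fun t ht => (hdiff t (hsub (hs (interior_subset ht)))).differentiableWithinAt)
      (fun t ht => ?_)
    rw [interior_Icc] at ht
    exact (hbelow t ht.1.le ht.2).le
  obtain ⟨v, hv, hT⟩ := hasTilt_of_mem_interior (hin (hsub hθZ.1))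
  rw [← hM, hzero, zero_div] at hT
  refine ⟨θ, M θ, v, (hsub hθZ.1).1, (hsub hθZ.1).2, hMle θ (Set.Ioo_subset_Icc_self (hsub hθZ.1)),
    hv, hT, fun κ hκ => ?_⟩
  set t := max θa (θ - κ) with ht
  have ht1 : θa ≤ t := le_max_left _ _
  have ht2 : t < θ := max_lt hlt (by linarith)
  have ht3 := hsub ⟨ht1, ht2.le.trans hθZ.1.2⟩
  obtain ⟨w, hw, hT'⟩ := hasTilt_of_mem_interior (hin ht3)
  refine ⟨t, M t, -(deriv M t / M t), w, ht3.1, ht2, by linarith [le_max_right θa (θ - κ)], ?_, hw,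
    hanti ⟨ht1, ht2.le⟩ ⟨hlt.le, le_rfl⟩ ht2.le, by rwa [neg_neg]⟩
  rw [neg_pos]
  exact div_neg_of_neg_of_pos (hbelow t ht1 ht2) hT'.pos

/-- Both signs are charged: without positive values E exp X = 1 would force X = 0, and without
negative values the mean could not be negative. Exhausting each half-line by compact intervals gives
common constants. -/
lemma exists_pos_measure_Icc (hexp : Integrable Real.exp μ) (hone : ∫ x, Real.exp x ∂μ = 1)
    (hneg : ∫ x, x ∂μ < 0) :
    ∃ a b p : ℝ, 0 < a ∧ a ≤ b ∧ 0 < p ∧ p ≤ 1 ∧ ENNReal.ofReal p ≤ μ (Set.Icc a b) ∧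
      ENNReal.ofReal p ≤ μ (Set.Icc (-b) (-a)) := by
  have hnz := not_ae_eq_zero_of_integral_neg hneg
  have hpos : μ (Set.Ioi 0) ≠ 0 := by
    intro h
    have hle : ∀ᵐ x ∂μ, x ≤ 0 := by
      rw [ae_iff]; simpa [Set.Ioi] using h
    have hz : ∫ x, (1 - Real.exp x) ∂μ = 0 := by
      rw [integral_sub (integrable_const 1) hexp, hone]; simp
    have hd : Integrable (fun x => 1 - Real.exp x) μ := (integrable_const 1).sub hexp
    rw [integral_eq_zero_iff_of_nonneg_ae (hle.mono fun x hx => by simpa using hx) hd] at hz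
    refine hnz (hz.mono fun x hx => ?_)
    have : Real.exp x = 1 := by simp at hx; linarith
    simpa using this
  have hneg' : μ (Set.Iio 0) ≠ 0 := by
    intro h
    have hle : ∀ᵐ x ∂μ, 0 ≤ x := by
      rw [ae_iff]; simpa [Set.Iio] using h
    exact hneg.not_ge (integral_nonneg_of_ae hle)
  have hU : Set.Ioi (0 : ℝ) ⊆ ⋃ n : ℕ, Set.Icc (1 / ((n : ℝ) + 1)) (n + 1) := by
    intro x hx
    obtain ⟨n, hn⟩ := exists_nat_one_div_lt (show (0 : ℝ) < x from hx)
    obtain ⟨k, hk⟩ := exists_nat_gt x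
    refine Set.mem_iUnion.2 ⟨max n k, ?_, ?_⟩
    · refine le_trans ?_ hn.le
      refine one_div_le_one_div_of_le (by positivity) ?_
      have : (n : ℝ) ≤ (max n k : ℕ) := by exact_mod_cast le_max_left n k
      linarith
    · have : (k : ℝ) ≤ (max n k : ℕ) := by exact_mod_cast le_max_right n k
      linarith
  have hU' : Set.Iio (0 : ℝ) ⊆ ⋃ n : ℕ, Set.Icc (-((n : ℝ) + 1)) (-(1 / ((n : ℝ) + 1))) := by
    intro x hx
    obtain ⟨n, hn⟩ := Set.mem_iUnion.1 (hU (show -x ∈ Set.Ioi (0 : ℝ) by simpa using hx))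
    exact Set.mem_iUnion.2 ⟨n, by linarith [hn.2], by linarith [hn.1]⟩
  obtain ⟨n, hn⟩ : ∃ n : ℕ, μ (Set.Icc (1 / ((n : ℝ) + 1)) (n + 1)) ≠ 0 := by
    by_contra! h
    exact hpos (measure_mono_null hU (measure_iUnion_null h))
  obtain ⟨k, hk⟩ : ∃ n : ℕ, μ (Set.Icc (-((n : ℝ) + 1)) (-(1 / ((n : ℝ) + 1)))) ≠ 0 := by
    by_contra! h
    exact hneg' (measure_mono_null hU' (measure_iUnion_null h))
  set N := max n k
  have hnN : (n : ℝ) ≤ N := by exact_mod_cast le_max_left n k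
  have hkN : (k : ℝ) ≤ N := by exact_mod_cast le_max_right n k
  have h1 : 1 / ((N : ℝ) + 1) ≤ 1 / ((n : ℝ) + 1) :=
    one_div_le_one_div_of_le (by positivity) (by linarith)
  have h2 : 1 / ((N : ℝ) + 1) ≤ 1 / ((k : ℝ) + 1) :=
    one_div_le_one_div_of_le (by positivity) (by linarith)
  have e1 : μ (Set.Icc (1 / ((N : ℝ) + 1)) (N + 1)) ≠ 0 := fun h =>
    hn (measure_mono_null (Set.Icc_subset_Icc h1 (by linarith)) h)
  have e2 : μ (Set.Icc (-((N : ℝ) + 1)) (-(1 / ((N : ℝ) + 1)))) ≠ 0 := fun h =>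
    hk (measure_mono_null (Set.Icc_subset_Icc (by linarith) (by linarith)) h)
  refine ⟨1 / ((N : ℝ) + 1), N + 1,
    min (μ.real (Set.Icc (1 / ((N : ℝ) + 1)) (N + 1)))
      (μ.real (Set.Icc (-((N : ℝ) + 1)) (-(1 / ((N : ℝ) + 1))))), by positivity, ?_, ?_, ?_, ?_, ?_⟩
  · have : 1 / ((N : ℝ) + 1) ≤ 1 := (div_le_one (by positivity)).2 (by linarith [N.cast_nonneg (α := ℝ)])
    linarith [N.cast_nonneg (α := ℝ)]
  · exact lt_min (ENNReal.toReal_pos e1 (measure_ne_top _ _))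
      (ENNReal.toReal_pos e2 (measure_ne_top _ _))
  · exact (min_le_left _ _).trans measureReal_le_one
  · exact ENNReal.ofReal_le_of_le_toReal (min_le_left _ _)
  · exact ENNReal.ofReal_le_of_le_toReal (min_le_right _ _)

end ExistsTilt

/-! ### Survival by hovering and by descending -/

section Survival

variable {μ : Measure ℝ} {A : ℝ}

/-- Hovering in a tube of radius `r` around the start: undoing the tilt costs at most `exp (-r)`,
and the condition on `t * v` keeps the Kolmogorov factor at 1/2 or more. -/
lemma HasTilt.ofReal_le_survival {θ ρ v : ℝ} (h : HasTilt μ θ ρ 0 v) (hθ : 0 ≤ θ) (hθ1 : θ ≤ 1)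
    (hv : 0 ≤ v) {r y : ℝ} (hr : 0 < r) (t : ℕ) (ht : t * v ≤ r ^ 2 / 2) (hy : r ≤ y)
    (hyA : y + r ≤ A) :
    ENNReal.ofReal (ρ ^ t * Real.exp (-r) / 2) ≤ (stripStep μ A)^[t] (fun _ => 1) y := by
  have key := h.le_stripStep_iterate hθ hv hr (A := A) (c := 1) (f := fun _ => 1) t y y
    (fun s _ => Set.Ioo_subset_Ioo (by linarith) (by linarith)) (fun _ _ => le_rfl)
  rw [one_mul] at key
  refine le_trans (ENNReal.ofReal_le_ofReal ?_) key
  have h1 : Real.exp (-r) ≤ Real.exp (θ * (y - y - 0 * t - r)) := by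
    rw [Real.exp_le_exp]; nlinarith
  have h2 : (1 : ℝ) / 2 ≤ 1 - ((y - y) ^ 2 + t * v) / r ^ 2 := by
    have : ((y - y) ^ 2 + t * v) / r ^ 2 ≤ 1 / 2 := by
      rw [div_le_iff₀ (by positivity)]; nlinarith
    linarith
  have hρ := h.pos
  calc ρ ^ t * Real.exp (-r) / 2 = ρ ^ t * Real.exp (-r) * (1 / 2) := by ring
    _ ≤ _ := by gcongr

lemma HasTilt.mul_ofReal_le_stripStep_iterate {θ ρ φ η v : ℝ} (h : HasTilt μ θ φ (-η) v)
    (hθ : 0 ≤ θ) (hθ1 : θ ≤ 1) (hη : 0 < η) (hv : 0 ≤ v) (hρ : 0 ≤ ρ) (hρφ : ρ ≤ φ) {r w : ℝ}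
    (hr : 0 < r) (k : ℕ) (hk : k * v ≤ r ^ 2 / 2) (hw : r ≤ w - η * k) (hwA : w + r ≤ A)
    {c : ℝ≥0∞} {f : ℝ → ℝ≥0∞} (hf : ∀ u ∈ Set.Ioo (w - η * k - r) (w - η * k + r), c ≤ f u) :
    c * ENNReal.ofReal (ρ ^ k * Real.exp (θ * (η * k) - r) / 2) ≤ (stripStep μ A)^[k] f w := by
  have key := h.le_stripStep_iterate hθ hv hr (A := A) (c := c) (f := f) k w w
    (fun s hs => ?_) (fun u hu => hf u (by convert hu using 2 <;> ring))
  · refine le_trans ?_ key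
    gcongr
    have h1 : Real.exp (θ * (η * k) - r) ≤ Real.exp (θ * (w - w - -η * k - r)) := by
      rw [Real.exp_le_exp]; nlinarith
    have h2 : (1 : ℝ) / 2 ≤ 1 - ((w - w) ^ 2 + k * v) / r ^ 2 := by
      have : ((w - w) ^ 2 + k * v) / r ^ 2 ≤ 1 / 2 := by
        rw [div_le_iff₀ (by positivity)]; nlinarith
      linarith
    have hφ := h.pos
    calc ρ ^ k * Real.exp (θ * (η * k) - r) / 2 = ρ ^ k * Real.exp (θ * (η * k) - r) * (1 / 2) := by
          ring
      _ ≤ _ := by gcongr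
  · have hs' : (s : ℝ) ≤ k := by exact_mod_cast hs
    have : η * s ≤ η * k := by gcongr
    have : 0 ≤ η * s := by positivity
    exact Set.Ioo_subset_Ioo (by linarith) (by linarith)

/-- Descend along slope `-η` to a height of order `r`, then hover for the rest of the `K` steps. The
descent gains `exp (θ₁ * w)` up to `exp (O(r))`, and both phases retain at least `ρ` per step. -/
lemma ofReal_le_survival_of_descent {θ ρ v θ₁ φ₁ η v₁ : ℝ} (h : HasTilt μ θ ρ 0 v)
    (hθ : 0 ≤ θ) (hθ1 : θ ≤ 1) (hv : 0 ≤ v) (h₁ : HasTilt μ θ₁ φ₁ (-η) v₁) (hθ₁ : 0 ≤ θ₁)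
    (hθ₁1 : θ₁ ≤ 1) (hη : 0 < η) (hv₁ : 0 ≤ v₁) (hρφ : ρ ≤ φ₁) {r w : ℝ} (hr : 0 < r)
    (hηr : η ≤ r) (K : ℕ) (hK : A / η ≤ K) (hKv : K * (v + v₁) ≤ r ^ 2 / 8) (hw : 2 * r ≤ w)
    (hwA : w + 2 * r ≤ A) (hrA : 5 * r ≤ A) :
    ENNReal.ofReal (ρ ^ K * Real.exp (θ₁ * w - 5 * r) / 4) ≤
      (stripStep μ A)^[K] (fun _ => 1) w := by
  have hρ := h.pos
  -- With this duration the descent line ends in [2r, 2r + η), so the tube of radius `r` around it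
  -- stays in the strip and leaves room for hovering with radius `r / 2`.
  set k := ⌊(w - 2 * r) / η⌋₊ with hk
  have hk1 : η * k ≤ w - 2 * r := by
    have := Nat.floor_le (show 0 ≤ (w - 2 * r) / η from div_nonneg (by linarith) hη.le)
    rw [← hk, le_div_iff₀ hη] at this
    linarith
  have hk2 : w - 2 * r < η * k + η := by
    have := Nat.lt_floor_add_one ((w - 2 * r) / η)
    rw [← hk, div_lt_iff₀ hη] at this
    linarith
  have hkK : k ≤ K := by
    have h1 : (k : ℝ) ≤ A / η := by
      rw [le_div_iff₀ hη]; linarith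
    exact_mod_cast h1.trans hK
  have hkK' : (k : ℝ) ≤ K := by exact_mod_cast hkK
  have hsub : ((K - k : ℕ) : ℝ) ≤ K := by exact_mod_cast Nat.sub_le _ _
  have hang : ∀ u ∈ Set.Ioo (w - η * k - r) (w - η * k + r),
      ENNReal.ofReal (ρ ^ (K - k) * Real.exp (-(r / 2)) / 2) ≤
        (stripStep μ A)^[K - k] (fun _ => 1) u := by
    intro u hu
    refine h.ofReal_le_survival hθ hθ1 hv (half_pos hr) _ ?_ ?_ ?_
    · have h1 : ((K - k : ℕ) : ℝ) * v ≤ K * v := by gcongr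
      have h2 : 0 ≤ (K : ℝ) * v₁ := by positivity
      nlinarith
    · linarith [hu.1]
    · linarith [hu.2]
  have key := h₁.mul_ofReal_le_stripStep_iterate hθ₁ hθ₁1 hη hv₁ hρ.le hρφ hr k
    (by
      have h1 : (k : ℝ) * v₁ ≤ K * v₁ := by gcongr
      have h2 : 0 ≤ (K : ℝ) * v := by positivity
      nlinarith [sq_nonneg r]) (by linarith) (by linarith) hang
  rw [← Function.iterate_add_apply, Nat.add_sub_cancel' hkK,
    ← ENNReal.ofReal_mul (by positivity)] at key
  refine le_trans (ENNReal.ofReal_le_ofReal ?_) key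
  have e1 : ρ ^ (K - k) * Real.exp (-(r / 2)) / 2 * (ρ ^ k * Real.exp (θ₁ * (η * k) - r) / 2) =
      ρ ^ K * Real.exp (θ₁ * (η * k) - r - r / 2) / 4 := by
    rw [show θ₁ * (η * k) - r - r / 2 = -(r / 2) + (θ₁ * (η * k) - r) by ring, Real.exp_add,
      ← Nat.sub_add_cancel hkK, pow_add, Nat.add_sub_cancel]
    ring
  rw [e1]
  have : Real.exp (θ₁ * w - 5 * r) ≤ Real.exp (θ₁ * (η * k) - r - r / 2) := by
    rw [Real.exp_le_exp]
    have : θ₁ * (w - 3 * r) ≤ θ₁ * (η * k) := by gcongr; linarith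
    nlinarith
  gcongr

end Survival

/-! ### The mean of the walk conditioned to stay in the strip -/

section Key

variable {μ : Measure ℝ} [IsProbabilityMeasure μ]

-- A start may be arbitrarily close to the boundary, so `N` forced steps, a small fraction of `A`,
-- first move the walk inside. `K` further steps, of order `A`, allow a full descent. The spread
-- over `K` steps is of order √A, far below the tube radius, which is proportional to `A`.
set_option maxHeartbeats 1000000 in
lemma exists_ofReal_le_survival (hexp : Integrable Real.exp μ) (hone : ∫ x, Real.exp x ∂μ = 1)
    (hneg : ∫ x, x ∂μ < 0) :
    ∃ θ ρ v, 0 < θ ∧ HasTilt μ θ ρ 0 v ∧ ∀ δ > 0, ∃ A₀ > 0, ∀ A ≥ A₀, ∃ j : ℕ,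
      (∀ y ∈ Set.Ioo 0 A, ENNReal.ofReal (ρ ^ j * Real.exp (θ * y - δ * A)) ≤
        (stripStep μ A)^[j] (fun _ => 1) y) ∧
      ∀ n ≤ j, ENNReal.ofReal (ρ ^ n * Real.exp (-(δ * A))) ≤
        (stripStep μ A)^[n] (fun _ => 1) 0 := by
  obtain ⟨θ, ρ, v, hθ, hθ1, hρ1, hv, hT, hclose⟩ := exists_hasTilt hexp hone hneg
  obtain ⟨a, b, p, ha, hab, hp, hp1, hpu, hpd⟩ := exists_pos_measure_Icc hexp hone hneg
  have hρ := hT.pos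
  refine ⟨θ, ρ, v, hθ, hT, fun δ hδ => ?_⟩
  obtain ⟨θ₁, φ₁, η, v₁, hθ₁, hθ₁θ, hκ, hη, hv₁, hρφ, hT₁⟩ := hclose (δ / 4) (by positivity)
  have hb : 0 < b := ha.trans_le hab
  set ℓ := -Real.log p with hℓ
  have hℓ0 : 0 ≤ ℓ := by rw [hℓ, neg_nonneg]; exact Real.log_nonpos hp.le hp1
  have hpℓ : p = Real.exp (-ℓ) := by rw [hℓ, neg_neg, Real.exp_log hp]
  -- Exponential cost per forced step: `ℓ` for its probability, `b` for the height it may lose, and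
  -- `5 * a / 2` because the later loss is `5 * r` with `r = N * a / 2`.
  set C := ℓ + b + 5 * a / 2 with hC
  have hCpos : 0 < C := by positivity
  set γ := min (δ / (4 * C)) (1 / (4 * (a + b))) with hγ
  have hγpos : 0 < γ := by positivity
  have hγC : γ * C ≤ δ / 4 := by
    calc γ * C ≤ δ / (4 * C) * C := by gcongr; exact min_le_left _ _
      _ = δ / 4 := by field_simp
  have hγab : γ * (a + b) ≤ 1 / 4 := by
    calc γ * (a + b) ≤ 1 / (4 * (a + b)) * (a + b) := by gcongr; exact min_le_right _ _
      _ = 1 / 4 := by field_simp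
  -- In order, the thresholds give `N ≥ γ * A / 2`, `η ≤ r`, `K * η ≤ 2 * A`, absorption of the
  -- factor 1/4, and the variance bound `hKv`.
  refine ⟨max (max (2 / γ) (4 * η / (γ * a))) (max (max η (8 / δ))
    (256 * (v + v₁) / (η * (γ * a) ^ 2))), by positivity, fun A hA => ?_⟩
  have hA1 : 2 / γ ≤ A := (le_max_left _ _).trans ((le_max_left _ _).trans hA)
  have hA2 : 4 * η / (γ * a) ≤ A := (le_max_right _ _).trans ((le_max_left _ _).trans hA)
  have hA3 : η ≤ A := (le_max_left _ _).trans ((le_max_left _ _).trans ((le_max_right _ _).trans hA))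
  have hA4 : 8 / δ ≤ A :=
    (le_max_right _ _).trans ((le_max_left _ _).trans ((le_max_right _ _).trans hA))
  have hA5 : 256 * (v + v₁) / (η * (γ * a) ^ 2) ≤ A :=
    (le_max_right _ _).trans ((le_max_right _ _).trans hA)
  have hApos : 0 < A := hη.trans_le hA3
  rw [div_le_iff₀ (by positivity)] at hA1 hA2 hA4 hA5
  set N := ⌊γ * A⌋₊ with hN
  have hN1 : (N : ℝ) ≤ γ * A := Nat.floor_le (by positivity)
  have hN2 : γ * A / 2 ≤ N := by
    have := Nat.lt_floor_add_one (γ * A)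
    rw [← hN] at this
    linarith
  have hNpos : 0 < (N : ℝ) := lt_of_lt_of_le (by positivity) hN2
  set r := N * a / 2 with hr
  have hrpos : 0 < r := by positivity
  have hrlow : γ * a * A / 4 ≤ r := by
    rw [hr]
    calc γ * a * A / 4 = γ * A / 2 * a / 2 := by ring
      _ ≤ N * a / 2 := by gcongr
  have hηr : η ≤ r := by linarith
  have hNab : N * (a + b) ≤ A / 4 := by
    calc N * (a + b) ≤ γ * A * (a + b) := by gcongr
      _ = γ * (a + b) * A := by ring
      _ ≤ 1 / 4 * A := by gcongr
      _ = A / 4 := by ring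
  have hNa : N * a ≤ N * b := by gcongr
  have hNaNb : N * a + N * b ≤ A / 4 := by linarith
  have hrA : 5 * r ≤ A := by linarith
  set K := ⌈A / η⌉₊ with hK
  have hK1 : A / η ≤ K := Nat.le_ceil _
  have hK2 : (K : ℝ) * η ≤ 2 * A := by
    have := Nat.ceil_lt_add_one (show 0 ≤ A / η by positivity)
    rw [← hK] at this
    calc (K : ℝ) * η ≤ (A / η + 1) * η := by gcongr
      _ = A + η := by field_simp
      _ ≤ 2 * A := by linarith
  have hKv : K * (v + v₁) ≤ r ^ 2 / 8 := by
    have h1 : (γ * a * A / 4) ^ 2 ≤ r ^ 2 := by gcongr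
    have h2 : (K * η) * (v + v₁) ≤ 2 * A * (v + v₁) := by gcongr
    have h3 : 256 * (v + v₁) * A ≤ A * (η * (γ * a) ^ 2) * A := by gcongr
    have h4 : η * (K * (v + v₁)) ≤ η * (r ^ 2 / 8) := by
      calc η * (K * (v + v₁)) = K * η * (v + v₁) := by ring
        _ ≤ 2 * A * (v + v₁) := h2
        _ = 256 * (v + v₁) * A / 128 := by ring
        _ ≤ A * (η * (γ * a) ^ 2) * A / 128 := by gcongr
        _ = η * ((γ * a * A / 4) ^ 2 / 8) := by ring
        _ ≤ η * (r ^ 2 / 8) := by gcongr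
    exact le_of_mul_le_mul_left h4 hη
  have hcost : Real.exp (-(δ * A) + δ / 4 * A) ≤
      p ^ N * Real.exp (-(N * b) - 5 * r) / 4 := by
    have h4 : Real.exp (-2) ≤ 1 / 4 := by
      rw [Real.exp_neg, one_div]
      have h2 : (2 : ℝ) ≤ Real.exp 1 := by linarith [Real.add_one_le_exp (1 : ℝ)]
      have : (4 : ℝ) ≤ Real.exp 2 := by
        rw [show (2 : ℝ) = 1 + 1 by norm_num, Real.exp_add]; nlinarith
      gcongr
    have h5 : p ^ N = Real.exp (-(N * ℓ)) := by
      rw [hpℓ, ← Real.exp_nat_mul]; congr 1; ring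
    have h6 : N * C ≤ δ / 4 * A := by
      calc N * C ≤ γ * A * C := by gcongr
        _ = γ * C * A := by ring
        _ ≤ _ := by gcongr
    calc Real.exp (-(δ * A) + δ / 4 * A) ≤ Real.exp (-(N * ℓ) + (-(N * b) - 5 * r) + -2) := by
          rw [Real.exp_le_exp]
          have : -(N * ℓ) + (-(N * b) - 5 * r) = -(N * C) := by rw [hC, hr]; ring
          rw [this]
          linarith
      _ = p ^ N * Real.exp (-(N * b) - 5 * r) * Real.exp (-2) := by
          rw [Real.exp_add, Real.exp_add, h5]
      _ ≤ p ^ N * Real.exp (-(N * b) - 5 * r) * (1 / 4) := by gcongr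
      _ = _ := by ring
  have hup : ∀ (y : ℝ) (n : ℕ), 0 ≤ y → y ≤ A / 2 → n ≤ N → ∀ {c : ℝ≥0∞} {f : ℝ → ℝ≥0∞},
      (∀ w ∈ Set.Icc (y + n * a) (y + n * b), c ≤ f w) →
      ENNReal.ofReal p ^ n * c ≤ (stripStep μ A)^[n] f y := by
    intro y n hy hyA hn c f hf
    refine pow_mul_le_stripStep_iterate hpu n y (fun k hk1 hkn => ?_) hf
    have hk1' : (1 : ℝ) ≤ k := by exact_mod_cast hk1
    have hkN : (k : ℝ) ≤ N := by exact_mod_cast hkn.trans hn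
    intro w hw
    have : (k : ℝ) * b ≤ N * b := by gcongr
    have : 0 < (k : ℝ) * a := by positivity
    have : 0 < N * a := by positivity
    exact ⟨by linarith [hw.1], by linarith [hw.2]⟩
  refine ⟨N + K, fun y hy => ?_, fun n hn => ?_⟩
  · rw [Function.iterate_add_apply]
    have hf : ∀ w, y - N * b ≤ w → 2 * r ≤ w → w + 2 * r ≤ A →
        ENNReal.ofReal (ρ ^ K * Real.exp (θ₁ * y - N * b - 5 * r) / 4) ≤
          (stripStep μ A)^[K] (fun _ => 1) w := by
      intro w hw1 hw2 hw3
      refine le_trans (ENNReal.ofReal_le_ofReal ?_) (ofReal_le_survival_of_descent hT hθ.le hθ1.le hv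
        hT₁ hθ₁.le (hθ₁θ.trans hθ1).le hη hv₁ hρφ hrpos hηr K hK1 hKv hw2 hw3 hrA)
      have : θ₁ * y - N * b - 5 * r ≤ θ₁ * w - 5 * r := by
        have h1 : θ₁ * (y - w) ≤ θ₁ * (N * b) := by gcongr; linarith
        have h2 : θ₁ * (N * b) ≤ 1 * (N * b) := by gcongr; linarith
        linarith
      gcongr
    have hstep : ENNReal.ofReal p ^ N *
        ENNReal.ofReal (ρ ^ K * Real.exp (θ₁ * y - N * b - 5 * r) / 4) ≤
        (stripStep μ A)^[N] ((stripStep μ A)^[K] fun _ => 1) y := by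
      -- From the lower half of the strip the forced steps go up, from the upper half down. Either
      -- way the walk ends at distance at least `N * a = 2 * r` from both ends.
      rcases le_or_gt y (A / 2) with hyA | hyA
      · refine hup y N hy.1.le hyA le_rfl fun w hw => hf w ?_ ?_ ?_
        · have : 0 < N * b := by positivity
          have : 0 < N * a := by positivity
          linarith [hw.1]
        · linarith [hw.1, hy.1]
        · linarith [hw.2]
      · refine pow_mul_le_stripStep_iterate hpd N y (fun k hk1 hkn => ?_) fun w hw => hf w ?_ ?_ ?_
        · have hk1' : (1 : ℝ) ≤ k := by exact_mod_cast hk1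
          have hkN : (k : ℝ) ≤ N := by exact_mod_cast hkn
          have : (k : ℝ) * b ≤ N * b := by gcongr
          have : 0 < (k : ℝ) * a := by positivity
          intro w hw
          have : 0 < N * a := by positivity
          exact ⟨by linarith [hw.1], by linarith [hw.2, hy.2]⟩
        · linarith [hw.1]
        · linarith [hw.1]
        · linarith [hw.2, hy.2]
    refine le_trans ?_ hstep
    rw [← ENNReal.ofReal_pow hp.le, ← ENNReal.ofReal_mul (by positivity)]
    refine ENNReal.ofReal_le_ofReal ?_
    have h1 : ρ ^ (N + K) ≤ ρ ^ K := pow_le_pow_of_le_one hρ.le hρ1 (Nat.le_add_left _ _)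
    have h2 : Real.exp (θ * y - δ * A) ≤ Real.exp (θ₁ * y) * Real.exp (-(δ * A) + δ / 4 * A) := by
      rw [← Real.exp_add, Real.exp_le_exp]
      have : (θ - θ₁) * y ≤ δ / 4 * A := mul_le_mul hκ hy.2.le hy.1.le (by positivity)
      linarith
    calc ρ ^ (N + K) * Real.exp (θ * y - δ * A)
        ≤ ρ ^ K * (Real.exp (θ₁ * y) * (p ^ N * Real.exp (-(N * b) - 5 * r) / 4)) := by
          gcongr
          exact h2.trans (by gcongr)
      _ = p ^ N * (ρ ^ K * Real.exp (θ₁ * y - N * b - 5 * r) / 4) := by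
          rw [show θ₁ * y - N * b - 5 * r = θ₁ * y + (-(N * b) - 5 * r) by ring, Real.exp_add]
          ring
  · have hexp1 : Real.exp (-(δ * A)) ≤ Real.exp (-(δ * A) + δ / 4 * A) := by
      rw [Real.exp_le_exp]
      have : 0 ≤ δ / 4 * A := by positivity
      linarith
    have hexp2 : Real.exp (-(N * b) - 5 * r) ≤ Real.exp (-(r / 2)) := by
      rw [Real.exp_le_exp]
      have : 0 < N * b := by positivity
      linarith
    have hexp3 : Real.exp (-(r / 2)) ≤ 1 := by
      rw [Real.exp_le_one_iff]; linarith
    have hcost' : Real.exp (-(δ * A)) ≤ p ^ N * (Real.exp (-(r / 2)) / 4) := by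
      refine hexp1.trans (hcost.trans ?_)
      rw [mul_div_assoc]
      gcongr
    rcases le_total n N with hnN | hnN
    · refine le_trans ?_ (hup 0 n le_rfl (by positivity) hnN (c := 1) fun _ _ => le_rfl)
      rw [mul_one, ← ENNReal.ofReal_pow hp.le]
      refine ENNReal.ofReal_le_ofReal ?_
      calc ρ ^ n * Real.exp (-(δ * A)) ≤ 1 * (p ^ N * 1) := by
            gcongr
            · exact pow_le_one₀ hρ.le hρ1
            · exact hcost'.trans (by gcongr; linarith [Real.exp_pos (-(r / 2))])
        _ ≤ p ^ n := by
            rw [one_mul, mul_one]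
            exact pow_le_pow_of_le_one hp.le hp1 hnN
    · obtain ⟨k, rfl⟩ := Nat.exists_eq_add_of_le hnN
      have hkK : (k : ℝ) ≤ K := by exact_mod_cast (Nat.add_le_add_iff_left.1 hn)
      rw [Function.iterate_add_apply]
      refine le_trans ?_ (hup 0 N le_rfl (by positivity) le_rfl
        (c := ENNReal.ofReal (ρ ^ k * Real.exp (-(r / 2)) / 2)) fun w hw => ?_)
      · rw [← ENNReal.ofReal_pow hp.le, ← ENNReal.ofReal_mul (by positivity)]
        refine ENNReal.ofReal_le_ofReal ?_
        calc ρ ^ (N + k) * Real.exp (-(δ * A)) ≤ ρ ^ k * (p ^ N * (Real.exp (-(r / 2)) / 2)) := by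
              gcongr ?_ * ?_
              · exact pow_le_pow_of_le_one hρ.le hρ1 (Nat.le_add_left _ _)
              · refine hcost'.trans ?_
                have := Real.exp_pos (-(r / 2))
                gcongr
                norm_num
          _ = _ := by ring
      · refine hT.ofReal_le_survival hθ.le hθ1.le hv (half_pos hrpos) k ?_ ?_ ?_
        · have h1 : (k : ℝ) * v ≤ K * v := by gcongr
          have h2 : 0 ≤ (K : ℝ) * v₁ := by positivity
          nlinarith
        · linarith [hw.1]
        · linarith [hw.2]

/-- The walk from `0` conditioned to have stayed in `(0, A)` for `n` steps has mean `o(A)`,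
uniformly in `n`. -/
theorem stripStep_iterate_ofReal_le (hexp : Integrable Real.exp μ)
    (hone : ∫ x, Real.exp x ∂μ = 1) (hneg : ∫ x, x ∂μ < 0) {ε : ℝ} (hε : 0 < ε) :
    ∃ A₀ : ℝ, ∀ A ≥ A₀, ∀ n : ℕ, (stripStep μ A)^[n] ENNReal.ofReal 0 ≤
      ENNReal.ofReal (ε * A) * (stripStep μ A)^[n] (fun _ => 1) 0 := by
  obtain ⟨θ, ρ, v, hθ, hT, hsurv⟩ := exists_ofReal_le_survival hexp hone hneg
  have hρ := hT.pos
  obtain ⟨A₁, hA₁, hsurv⟩ := hsurv (θ * ε / 4) (by positivity)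
  have hlim : Tendsto (fun A : ℝ => Real.exp (-(θ * ε / 4 * A))) atTop (nhds 0) :=
    Real.tendsto_exp_neg_atTop_nhds_zero.comp
      (tendsto_id.const_mul_atTop (show 0 < θ * ε / 4 by positivity))
  obtain ⟨A₂, hA₂⟩ := eventually_atTop.1 (hlim.eventually_le_const (show (0 : ℝ) < ε / 2 by positivity))
  refine ⟨max A₁ A₂, fun A hA => ?_⟩
  have hApos : 0 < A := hA₁.trans_le ((le_max_left _ _).trans hA)
  have hAe := hA₂ A ((le_max_right _ _).trans hA)
  obtain ⟨j, hj1, hj2⟩ := hsurv A ((le_max_left _ _).trans hA)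
  set T := stripStep μ A with hTdef
  -- Chosen so that `c * exp (θ * y)` is at least `A`, hence at least `y`, once `y ≥ ε / 2 * A`.
  set c := A * Real.exp (-(θ * ε / 2 * A)) with hc
  have hcpos : 0 < c := by positivity
  have hsup : ∀ (n : ℕ) (y : ℝ), y < A → T^[n] ENNReal.ofReal y ≤
      ENNReal.ofReal (ε / 2 * A) * T^[n] (fun _ => 1) y +
        ENNReal.ofReal (c * ρ ^ n * Real.exp (θ * y)) := by
    intro n
    induction n with
    | zero =>
      intro y hy
      simp only [Function.iterate_zero, id, mul_one, pow_zero]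
      rw [← ENNReal.ofReal_add (by positivity) (by positivity)]
      refine ENNReal.ofReal_le_ofReal ?_
      rcases le_total y (ε / 2 * A) with h | h
      · have : 0 < c * Real.exp (θ * y) := by positivity
        linarith
      · have h1 : c * Real.exp (θ * y) = A * Real.exp (θ * (y - ε / 2 * A)) := by
          rw [hc, mul_assoc, ← Real.exp_add]; congr 2; ring
        have h2 : 1 ≤ Real.exp (θ * (y - ε / 2 * A)) :=
          Real.one_le_exp (mul_nonneg hθ.le (by linarith))
        have h3 : 0 < ε / 2 * A := by positivity
        nlinarith
    | succ n ih =>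
      intro y _
      rw [Function.iterate_succ_apply', Function.iterate_succ_apply']
      -- The exponential is an eigenfunction of the unkilled walk, so the induction just drops the
      -- killing in this term.
      have hint : ∫⁻ x, ENNReal.ofReal (c * ρ ^ n * Real.exp (θ * (y + x))) ∂μ =
          ENNReal.ofReal (c * ρ ^ (n + 1) * Real.exp (θ * y)) := by
        have he : ∀ x, c * ρ ^ n * Real.exp (θ * (y + x)) =
            c * ρ ^ n * Real.exp (θ * y) * Real.exp (θ * x) := by
          intro x; rw [mul_add, Real.exp_add]; ring
        simp_rw [he]
        rw [← ofReal_integral_eq_lintegral_ofReal (hT.int_zero.const_mul _)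
          (.of_forall fun x => by positivity), integral_const_mul, hT.mass]
        congr 1; ring
      rw [← hint, hTdef, stripStep, stripStep, ← lintegral_const_mul' _ _ ENNReal.ofReal_ne_top,
        ← lintegral_add_right _ (by fun_prop)]
      refine lintegral_mono fun x => ?_
      by_cases hx : y + x ∈ Set.Ioo 0 A
      · simpa [Set.indicator_of_mem hx] using ih _ hx.2
      · simp [Set.indicator_of_notMem hx]
  have hcomb : ∀ (n : ℕ) (y : ℝ), y < A →
      ENNReal.ofReal (ρ ^ n * Real.exp (θ * y - θ * ε / 4 * A)) ≤ T^[n] (fun _ => 1) y →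
      T^[n] ENNReal.ofReal y ≤ ENNReal.ofReal (ε * A) * T^[n] (fun _ => 1) y := by
    intro n y hy h
    have h1 : ENNReal.ofReal (c * ρ ^ n * Real.exp (θ * y)) ≤
        ENNReal.ofReal (ε / 2 * A) * T^[n] (fun _ => 1) y := by
      have h2 : c * ρ ^ n * Real.exp (θ * y) = A * Real.exp (-(θ * ε / 4 * A)) *
          (ρ ^ n * Real.exp (θ * y - θ * ε / 4 * A)) := by
        rw [hc, show θ * y - θ * ε / 4 * A = θ * y + -(θ * ε / 4 * A) by ring, Real.exp_add,
          show -(θ * ε / 2 * A) = -(θ * ε / 4 * A) + -(θ * ε / 4 * A) by ring, Real.exp_add]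
        ring
      rw [h2, ENNReal.ofReal_mul (by positivity)]
      refine mul_le_mul' (ENNReal.ofReal_le_ofReal ?_) h
      rw [mul_comm]
      gcongr
    refine (hsup n y hy).trans ?_
    calc _ ≤ ENNReal.ofReal (ε / 2 * A) * T^[n] (fun _ => 1) y +
          ENNReal.ofReal (ε / 2 * A) * T^[n] (fun _ => 1) y := by gcongr
      _ = ENNReal.ofReal (ε * A) * T^[n] (fun _ => 1) y := by
          rw [← add_mul, ← ENNReal.ofReal_add (by positivity) (by positivity)]
          congr 2; ring
  intro n
  rcases le_or_gt n j with hn | hn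
  · exact hcomb n 0 hApos (by simpa using hj2 n hn)
  -- For `n > j` the inequality at time `j`, valid throughout the strip, is carried on by the
  -- remaining `k + 1` killed steps; no survival estimate at time `n` is used.
  · obtain ⟨k, rfl⟩ := Nat.exists_eq_add_of_le' hn
    rw [show k + (j + 1) = (k + 1) + j by ring, Function.iterate_add_apply T (k + 1) j,
      Function.iterate_add_apply T (k + 1) j]
    have := stripStep_iterate_succ_mono (μ := μ) (A := A)
      (fun w hw => hcomb j w hw.2 (hj1 w hw)) k 0
    refine this.trans (le_of_eq ?_)
    rw [stripStep_iterate_const_mul ENNReal.ofReal_ne_top]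

end Key

/-! ### Truncated and exponential moments of an increment -/

section Increment

variable {μ : Measure ℝ}

/-- Capping the increments from above bounds the overshoot over `A` at an arbitrarily small loss of
drift, by dominated convergence. -/
lemma exists_lt_integral_min (hint : Integrable (fun x => x) μ) [IsFiniteMeasure μ] {J : ℝ}
    (hJ : J < ∫ x, x ∂μ) : ∃ c : ℝ, 0 ≤ c ∧ ∀ c' ≥ c, J ≤ ∫ x, min x c' ∂μ := by
  have hi : ∀ c : ℝ, Integrable (fun x => min x c) μ := fun c => hint.inf (integrable_const c)
  have hlim : Tendsto (fun n : ℕ => ∫ x, min x (n : ℝ) ∂μ) atTop (nhds (∫ x, x ∂μ)) := by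
    refine tendsto_integral_of_dominated_convergence (fun x => |x|)
      (fun n => (hi n).aestronglyMeasurable) hint.abs (fun n => .of_forall fun x => ?_)
      (.of_forall fun x => ?_)
    · rw [Real.norm_eq_abs]
      have hn : (0 : ℝ) ≤ n := n.cast_nonneg
      rcases le_total x n with h | h
      · rw [min_eq_left h]
      · rw [min_eq_right h, abs_of_nonneg hn]; exact h.trans (le_abs_self x)
    · refine tendsto_const_nhds.congr' ?_
      filter_upwards [tendsto_natCast_atTop_atTop.eventually_ge_atTop x] with n hn
      rw [min_eq_left hn]
  obtain ⟨n, hn⟩ := (hlim.eventually_const_lt hJ).exists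
  exact ⟨n, n.cast_nonneg, fun c' hc => hn.le.trans
    (integral_mono (hi n) (hi c') fun x => min_le_min le_rfl hc)⟩

lemma exists_integral_max_lt (hint : Integrable (fun x => x) μ) [IsFiniteMeasure μ] {J : ℝ}
    (hJ : ∫ x, x ∂μ < -J) : ∃ c : ℝ, 0 ≤ c ∧ ∀ c' ≥ c, ∫ x, max x (-c') ∂μ ≤ -J := by
  have hmap : Integrable (fun x => x) (μ.map Neg.neg) :=
    (integrable_map_measure (by fun_prop) (by fun_prop)).2 hint.neg
  have hJ' : J < ∫ x, x ∂(μ.map Neg.neg) := by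
    rw [integral_map (by fun_prop) (by fun_prop), integral_neg]; linarith
  obtain ⟨c, hc, h⟩ := exists_lt_integral_min hmap hJ'
  refine ⟨c, hc, fun c' hc' => ?_⟩
  have := h c' hc'
  rw [integral_map (by fun_prop) (by fun_prop)] at this
  have he : ∀ x : ℝ, min (-x) c' = -max x (-c') := fun x => by
    rcases le_total (-x) c' with h | h
    · rw [min_eq_left h, max_eq_left (by linarith)]
    · rw [min_eq_right h, max_eq_right (by linarith), neg_neg]
  simp_rw [he, integral_neg] at this
  linarith

variable [IsProbabilityMeasure μ]

/-- The right derivative at 0 of t ↦ E exp(-tX) is -E X < 0, so this function drops below its value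
1 for small t > 0. Convexity of the exponential supplies the domination. -/
lemma exists_integral_exp_neg_le_one (hint : Integrable (fun x => x) μ)
    (hexp : Integrable (fun x => Real.exp (-x)) μ) (hpos : 0 < ∫ x, x ∂μ) :
    ∃ ℓ > 0, Integrable (fun x => Real.exp (-(ℓ * x))) μ ∧ ∫ x, Real.exp (-(ℓ * x)) ∂μ ≤ 1 := by
  have hconv : ∀ t ∈ Set.Icc (0 : ℝ) 1, ∀ x : ℝ,
      Real.exp (-(t * x)) ≤ (1 - t) + t * Real.exp (-x) := by
    intro t ht x
    have := convexOn_exp.2 (Set.mem_univ 0) (Set.mem_univ (-x)) (sub_nonneg.2 ht.2) ht.1 (by ring)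
    simpa using this
  have hi : ∀ t ∈ Set.Icc (0 : ℝ) 1, Integrable (fun x => Real.exp (-(t * x))) μ := by
    intro t ht
    refine ((integrable_const (1 - t)).add (hexp.const_mul t)).mono' (by fun_prop)
      (.of_forall fun x => ?_)
    rw [Real.norm_eq_abs, Real.abs_exp]
    exact hconv t ht x
  have hev : ∀ᶠ t : ℝ in nhdsWithin 0 (Set.Ioi 0), t ∈ Set.Ioc (0 : ℝ) 1 :=
    Ioc_mem_nhdsGT one_pos
  have hlim : Tendsto (fun t : ℝ => ∫ x, t⁻¹ * (Real.exp (-(t * x)) - 1) ∂μ)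
      (nhdsWithin 0 (Set.Ioi 0)) (nhds (∫ x, -x ∂μ)) := by
    refine tendsto_integral_filter_of_dominated_convergence (fun x => |x| + Real.exp (-x))
      (.of_forall fun t => by fun_prop) ?_ (hint.abs.add hexp) (.of_forall fun x => ?_)
    · filter_upwards [hev] with t ht
      refine .of_forall fun x => ?_
      have h1 := hconv t ⟨ht.1.le, ht.2⟩ x
      have h2 := Real.add_one_le_exp (-(t * x))
      rw [Real.norm_eq_abs, abs_le]
      constructor
      · have : -x ≤ t⁻¹ * (Real.exp (-(t * x)) - 1) := by
          rw [inv_mul_eq_div, le_div_iff₀ ht.1]; linarith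
        linarith [le_abs_self x, Real.exp_pos (-x)]
      · have : t⁻¹ * (Real.exp (-(t * x)) - 1) ≤ Real.exp (-x) - 1 := by
          rw [inv_mul_eq_div, div_le_iff₀ ht.1]; linarith
        linarith [abs_nonneg x]
    · have hd : HasDerivAt (fun t : ℝ => Real.exp (-(t * x))) (-x) 0 := by
        have := ((hasDerivAt_id (0 : ℝ)).mul_const x).neg.exp
        simpa using this
      have := (hasDerivAt_iff_tendsto_slope_zero.1 hd).mono_left
        (nhdsWithin_mono 0 (s := Set.Ioi 0) fun t ht => ne_of_gt ht)
      simpa using this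
  rw [integral_neg] at hlim
  obtain ⟨t, ht, hneg⟩ := (hev.and (hlim.eventually_lt_const (neg_lt_zero.2 hpos))).exists
  have ht' := hi t ⟨ht.1.le, ht.2⟩
  refine ⟨t, ht.1, ht', ?_⟩
  rw [integral_const_mul, integral_sub ht' (integrable_const 1)] at hneg
  have := neg_of_mul_neg_right hneg (inv_nonneg.2 ht.1.le)
  simp at this
  linarith

/-- This strict inequality makes the number of failed attempts by affected units geometric, so the
restart cost `κ` of the supersolution is finite. -/
lemma integral_min_one_exp_neg_lt_one (hpos : 0 < ∫ x, x ∂μ) {ℓ : ℝ} (hℓ : 0 < ℓ) :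
    ∫ x, min 1 (Real.exp (-(ℓ * x))) ∂μ < 1 := by
  have hi : Integrable (fun x => min 1 (Real.exp (-(ℓ * x)))) μ :=
    (integrable_const (1 : ℝ)).mono' (by fun_prop) (.of_forall fun x => by
      rw [Real.norm_eq_abs, abs_of_nonneg (le_min zero_le_one (Real.exp_pos _).le)]
      exact min_le_left _ _)
  have hle : ∫ x, min 1 (Real.exp (-(ℓ * x))) ∂μ ≤ 1 := by
    calc _ ≤ ∫ _, (1 : ℝ) ∂μ := integral_mono hi (integrable_const _) fun x => min_le_left _ _
      _ = 1 := by simp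
  refine lt_of_le_of_ne hle fun heq => ?_
  have hz : ∫ x, (1 - min 1 (Real.exp (-(ℓ * x)))) ∂μ = 0 := by
    rw [integral_sub (integrable_const 1) hi, heq]; simp
  have hd : Integrable (fun x => 1 - min 1 (Real.exp (-(ℓ * x)))) μ := (integrable_const 1).sub hi
  rw [integral_eq_zero_iff_of_nonneg (fun x => sub_nonneg.2 (min_le_left _ _)) hd] at hz
  refine hpos.not_ge (integral_nonpos_of_ae ?_)
  filter_upwards [hz] with x hx
  have h1 : min 1 (Real.exp (-(ℓ * x))) = 1 := by
    have : 1 - min 1 (Real.exp (-(ℓ * x))) = 0 := hx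
    linarith
  have h2 : 1 ≤ Real.exp (-(ℓ * x)) := h1 ▸ min_le_right _ _
  rw [Real.one_le_exp_iff] at h2
  exact nonpos_of_mul_nonpos_right (show ℓ * x ≤ 0 by linarith) hℓ

end Increment

/-! ### The supersolution for the time to alarm -/

lemma val_iterate_add_one {L : ℕ} [NeZero L] (k : ℕ) (i : Fin L) :
    ((fun j : Fin L => j + 1)^[k] i).val = (i.val + k) % L := by
  induction k with
  | zero => simp [Nat.mod_eq_of_lt i.isLt]
  | succ k ih =>
    rw [Function.iterate_succ_apply', Fin.val_add, ih, Fin.val_one']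
    rw [← Nat.add_mod, add_assoc]

/-- The number of cyclic steps from a position to the next one that satisfies `p`. -/
lemma exists_cyclic_distance {L : ℕ} [NeZero L] {p : Fin L → Prop} (hp : ∃ i, p i) :
    ∃ d : Fin L → ℕ, (∀ i, d i = 0 ↔ p i) ∧ ∀ i, ¬ p i → d (i + 1) + 1 = d i := by
  classical
  have hex : ∀ i : Fin L, ∃ k : ℕ, p ((fun j => j + 1)^[k] i) := by
    intro i
    obtain ⟨i₀, hi₀⟩ := hp
    -- Grouping `L - i` first avoids truncated subtraction; the surplus `L` vanishes modulo `L`.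
    refine ⟨i₀.val + (L - i.val), ?_⟩
    convert hi₀
    ext
    rw [val_iterate_add_one, show i.val + (i₀.val + (L - i.val)) = i₀.val + L by omega]
    simp [Nat.mod_eq_of_lt i₀.isLt]
  refine ⟨fun i => Nat.find (hex i), fun i => by simp [Nat.find_eq_zero], fun i hi => ?_⟩
  have := Nat.find_comp_succ (hex i) (hex (i + 1)) (by simpa using hi)
  exact this.symm

section Lyapunov

variable {L : ℕ}

/-- A function that dominates the mean time to alarm from the state `(y, i)` after the change.
`d i` counts the unaffected units that come before the next affected one, starting with `i`. -/
noncomputable def timeBound (A c J b J₁ κ q : ℝ) (ℓ : Fin L → ℝ) (d : Fin L → ℕ) (y : ℝ)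
    (i : Fin L) : ℝ :=
  if d i = 0 then
    if y ≤ 0 then (A + c) / J + κ * q else (A + c - y) / J + κ * Real.exp (-(ℓ i * y))
  else max y 0 / J₁ + d i * (b / J₁) + ((A + c) / J + κ * q)

variable {A c J b J₁ κ q : ℝ} {ℓ : Fin L → ℝ} {d : Fin L → ℕ}

lemma timeBound_of_nonpos {y : ℝ} (hy : y ≤ 0) (i : Fin L) :
    timeBound A c J b J₁ κ q ℓ d y i = d i * (b / J₁) + ((A + c) / J + κ * q) := by
  unfold timeBound
  split_ifs with h
  · simp [h]
  · simp [max_eq_right hy]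

lemma measurable_timeBound (i : Fin L) :
    Measurable fun y => timeBound A c J b J₁ κ q ℓ d y i := by
  unfold timeBound
  split_ifs with h
  · exact Measurable.ite measurableSet_Iic (by fun_prop) (by fun_prop)
  · fun_prop

variable [NeZero L]

/-- The bound decreases by at least `1` on average in one step of the policy. -/
lemma one_add_lintegral_timeBound_le {μ : Measure ℝ} [IsProbabilityMeasure μ]
    (hint : Integrable (fun x => x) μ) (i : Fin L) (hJ : 0 < J) (hJ₁ : 0 < J₁) (hA : 0 < A)
    (hc : 0 ≤ c) (hb : 0 ≤ b) (hκ : 0 ≤ κ) (hq : 0 ≤ q)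
    (hκq : ∀ j, d j * (b / J₁) + κ * q ≤ κ) (hd : d i ≠ 0 → d (i + 1) + 1 = d i)
    (haff : d i = 0 → J ≤ ∫ x, min x c ∂μ ∧ 0 < ℓ i ∧
      Integrable (fun x => Real.exp (-(ℓ i * x))) μ ∧ ∫ x, Real.exp (-(ℓ i * x)) ∂μ ≤ 1 ∧
      ∫ x, min 1 (Real.exp (-(ℓ i * x))) ∂μ ≤ q)
    (hun : d i ≠ 0 → ∫ x, max x (-b) ∂μ ≤ -J₁) {y : ℝ} (hy : y < A) :
    1 + ∫⁻ x, (if max y 0 + x < A then ENNReal.ofReal (timeBound A c J b J₁ κ q ℓ d (max y 0 + x)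
      (if max y 0 + x ≤ 0 then i + 1 else i)) else 0) ∂μ ≤
      ENNReal.ofReal (timeBound A c J b J₁ κ q ℓ d y i) := by
  set m := max y 0 with hm
  have hm0 : 0 ≤ m := le_max_right _ _
  have hmA : m < A := max_lt hy hA
  -- It is enough to dominate the next value by an integrable `Φ ≥ 0`. Truncating the increment,
  -- above for affected units and below for unaffected ones, makes `Φ` non-negative.
  suffices h : ∃ Φ : ℝ → ℝ, Integrable Φ μ ∧ (∀ x, 0 ≤ Φ x) ∧
      (∀ x, m + x < A → timeBound A c J b J₁ κ q ℓ d (m + x) (if m + x ≤ 0 then i + 1 else i) ≤ Φ x) ∧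
      1 + ∫ x, Φ x ∂μ ≤ timeBound A c J b J₁ κ q ℓ d y i by
    obtain ⟨Φ, hΦi, hΦ0, hle, hfin⟩ := h
    calc _ ≤ 1 + ∫⁻ x, ENNReal.ofReal (Φ x) ∂μ := by
          gcongr with x
          by_cases h1 : m + x < A
          · rw [if_pos h1]
            exact ENNReal.ofReal_le_ofReal (hle x h1)
          · rw [if_neg h1]
            exact zero_le
      _ = ENNReal.ofReal (1 + ∫ x, Φ x ∂μ) := by
          rw [← ofReal_integral_eq_lintegral_ofReal hΦi (.of_forall hΦ0),
            ENNReal.ofReal_add zero_le_one (integral_nonneg hΦ0), ENNReal.ofReal_one]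
      _ ≤ _ := ENNReal.ofReal_le_ofReal hfin
  -- Entering any unit afresh costs no more than staying at height 0 with the full penalty `κ`,
  -- which is what `Φ` charges when an affected unit is abandoned.
  have hentry : ∀ j, d j * (b / J₁) + ((A + c) / J + κ * q) ≤ (A + c) / J + κ := fun j => by
    linarith [hκq j]
  by_cases hdi : d i = 0
  · obtain ⟨hJle, hℓ, hei, he1, hqle⟩ := haff hdi
    have imin : Integrable (fun x => min x c) μ := hint.inf (integrable_const c)
    have hem : ∀ x, Real.exp (-(ℓ i * (m + x))) = Real.exp (-(ℓ i * m)) * Real.exp (-(ℓ i * x)) :=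
      fun x => by rw [← Real.exp_add]; congr 1; ring
    have imin1 : Integrable (fun x => min 1 (Real.exp (-(ℓ i * (m + x))))) μ :=
      (integrable_const (1 : ℝ)).mono' (by fun_prop) (.of_forall fun x => by
        rw [Real.norm_eq_abs, abs_of_nonneg (le_min zero_le_one (Real.exp_pos _).le)]
        exact min_le_left _ _)
    have iΦ1 : Integrable (fun x => (A + c - (m + min x c)) / J) μ :=
      ((integrable_const _).sub ((integrable_const _).add imin)).div_const J
    refine ⟨fun x => (A + c - (m + min x c)) / J + κ * min 1 (Real.exp (-(ℓ i * (m + x)))),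
      iΦ1.add (imin1.const_mul κ), fun x => ?_, fun x hx => ?_, ?_⟩
    · have : 0 ≤ A + c - (m + min x c) := by linarith [min_le_right x c]
      have : 0 ≤ min 1 (Real.exp (-(ℓ i * (m + x)))) := le_min zero_le_one (Real.exp_pos _).le
      positivity
    · have hmin : (A + c - (m + x)) / J ≤ (A + c - (m + min x c)) / J := by
        gcongr; exact min_le_left _ _
      split_ifs with h
      · rw [timeBound_of_nonpos h]
        refine (hentry _).trans ?_
        have h1 : min 1 (Real.exp (-(ℓ i * (m + x)))) = 1 :=
          min_eq_left (Real.one_le_exp (by nlinarith))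
        have h2 : (A + c) / J ≤ (A + c - (m + x)) / J := by gcongr; linarith
        simp only [h1]
        linarith
      · have h1 : min 1 (Real.exp (-(ℓ i * (m + x)))) = Real.exp (-(ℓ i * (m + x))) :=
          min_eq_right (Real.exp_le_one_iff.2 (by nlinarith))
        simp only [timeBound, hdi, if_true, h, if_false, h1]
        linarith
    · have hI : ∫ x, ((A + c - (m + min x c)) / J + κ * min 1 (Real.exp (-(ℓ i * (m + x))))) ∂μ =
          (A + c - (m + ∫ x, min x c ∂μ)) / J +
            κ * ∫ x, min 1 (Real.exp (-(ℓ i * (m + x)))) ∂μ := by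
        have e1 : ∫ x, (A + c - (m + min x c)) ∂μ = A + c - (m + ∫ x, min x c ∂μ) := by
          have : ∀ x, A + c - (m + min x c) = (A + c - m) - min x c := fun x => by ring
          simp_rw [this]
          rw [integral_sub (integrable_const _) imin]
          simp; ring
        rw [integral_add iΦ1 (imin1.const_mul κ), integral_const_mul, integral_div, e1]
      rw [hI]
      have h1 : 1 + (A + c - (m + ∫ x, min x c ∂μ)) / J ≤ (A + c - m) / J := by
        rw [show (A + c - (m + ∫ x, min x c ∂μ)) / J = (A + c - m) / J - (∫ x, min x c ∂μ) / J by
          ring]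
        have : 1 ≤ (∫ x, min x c ∂μ) / J := (one_le_div hJ).2 hJle
        linarith
      unfold timeBound
      rw [if_pos hdi]
      split_ifs with h
      · have hm' : m = 0 := max_eq_right h
        simp only [hm', zero_add, sub_zero] at h1 ⊢
        have := mul_le_mul_of_nonneg_left hqle hκ
        linarith
      · have hm' : m = y := max_eq_left (not_le.1 h).le
        have h2 : ∫ x, min 1 (Real.exp (-(ℓ i * (m + x)))) ∂μ ≤ Real.exp (-(ℓ i * m)) := by
          calc _ ≤ ∫ x, Real.exp (-(ℓ i * m)) * Real.exp (-(ℓ i * x)) ∂μ :=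
                integral_mono imin1 (hei.const_mul _) fun x => (min_le_right _ _).trans (hem x).le
            _ = Real.exp (-(ℓ i * m)) * ∫ x, Real.exp (-(ℓ i * x)) ∂μ := integral_const_mul _ _
            _ ≤ Real.exp (-(ℓ i * m)) * 1 := by gcongr
            _ = _ := mul_one _
        have := mul_le_mul_of_nonneg_left h2 hκ
        rw [hm'] at h1 this ⊢
        linarith
  · have hd' := hd hdi
    have hdr : (d i : ℝ) = d (i + 1) + 1 := by rw [← hd']; push_cast; ring
    have imax : Integrable (fun x => max x (-b)) μ := hint.sup (integrable_const (-b))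
    have hW : 0 ≤ (d (i + 1) : ℝ) * (b / J₁) + ((A + c) / J + κ * q) := by positivity
    refine ⟨fun x => (m + max x (-b) + b) / J₁ + (d (i + 1) * (b / J₁) + ((A + c) / J + κ * q)),
      ((((integrable_const m).add imax).add (integrable_const b)).div_const J₁).add
        (integrable_const _), fun x => ?_, fun x hx => ?_, ?_⟩
    · have : 0 ≤ m + max x (-b) + b := by linarith [le_max_right x (-b)]
      positivity
    · split_ifs with h
      · rw [timeBound_of_nonpos h]
        have : 0 ≤ (m + max x (-b) + b) / J₁ := by
          have : 0 ≤ m + max x (-b) + b := by linarith [le_max_right x (-b)]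
          positivity
        linarith
      · simp only [timeBound, hdi, if_false]
        rw [max_eq_left (not_le.1 h).le, hdr]
        have : (m + x + b) / J₁ ≤ (m + max x (-b) + b) / J₁ := by
          gcongr; exact le_max_left _ _
        rw [add_div] at this
        linarith
    · have hI : ∫ x, ((m + max x (-b) + b) / J₁ +
          (d (i + 1) * (b / J₁) + ((A + c) / J + κ * q))) ∂μ =
          (m + (∫ x, max x (-b) ∂μ) + b) / J₁ +
            (d (i + 1) * (b / J₁) + ((A + c) / J + κ * q)) := by
        have i1 : Integrable (fun x => m + max x (-b)) μ := (integrable_const m).add imax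
        have i2 : Integrable (fun x => m + max x (-b) + b) μ := i1.add (integrable_const b)
        rw [integral_add (i2.div_const J₁) (integrable_const _), integral_div,
          integral_add i1 (integrable_const b), integral_add (integrable_const m) imax]
        simp
      rw [hI]
      unfold timeBound
      rw [if_neg hdi, hdr, ← hm]
      have h1 : (m + (∫ x, max x (-b) ∂μ) + b) / J₁ ≤ (m + -J₁ + b) / J₁ := by
        gcongr; exact hun hdi
      have h2 : (m + -J₁ + b) / J₁ = m / J₁ - 1 + b / J₁ := by
        field_simp; ring
      linarith

/-- A supersolution for the mean time to alarm, with its asymptotics in the threshold `A`. -/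
theorem exists_time_supersolution {p : Fin L → Prop} (hp : ∃ i, p i) (μ : Fin L → Measure ℝ)
    [∀ i, IsProbabilityMeasure (μ i)] (hint : ∀ i, Integrable (fun x => x) (μ i))
    (hpos : ∀ i, p i → 0 < ∫ x, x ∂(μ i))
    (hexp : ∀ i, p i → Integrable (fun x => Real.exp (-x)) (μ i))
    (hneg : ∀ i, ¬ p i → ∫ x, x ∂(μ i) < 0) :
    ∃ C₂ : ℝ, 0 ≤ C₂ ∧ ∀ J > 0, (∀ i, p i → J < ∫ x, x ∂(μ i)) → ∃ C₁ : ℝ, ∀ A > 0,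
      ∃ h : ℝ → Fin L → ℝ, (∀ i, Measurable fun y => h y i) ∧
        (∀ i, ∀ y < A, 1 + ∫⁻ x, (if max y 0 + x < A then ENNReal.ofReal (h (max y 0 + x)
          (if max y 0 + x ≤ 0 then i + 1 else i)) else 0) ∂(μ i) ≤ ENNReal.ofReal (h y i)) ∧
        (∀ i y, p i → h y i ≤ A / J + C₁) ∧
        ∀ i y, ¬ p i → h y i ≤ A / J + C₁ + C₂ * max y 0 := by
  classical
  obtain ⟨d, hd0, hds⟩ := exists_cyclic_distance hp
  have hℓ : ∀ i, ∃ ℓ : ℝ, p i → 0 < ℓ ∧ Integrable (fun x => Real.exp (-(ℓ * x))) (μ i) ∧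
      ∫ x, Real.exp (-(ℓ * x)) ∂(μ i) ≤ 1 := by
    intro i
    by_cases h : p i
    · obtain ⟨ℓ, h1, h2, h3⟩ := exists_integral_exp_neg_le_one (hint i) (hexp i h) (hpos i h)
      exact ⟨ℓ, fun _ => ⟨h1, h2, h3⟩⟩
    · exact ⟨0, fun h' => absurd h' h⟩
  choose ℓ hℓ using hℓ
  obtain ⟨q, hq0, hq1, hq⟩ : ∃ q : ℝ, 0 ≤ q ∧ q < 1 ∧
      ∀ i, p i → ∫ x, min 1 (Real.exp (-(ℓ i * x))) ∂(μ i) ≤ q := by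
    obtain ⟨i₀, hi₀⟩ := hp
    obtain ⟨i, hi, hmax⟩ := Finset.exists_max_image (Finset.univ.filter p)
      (fun i => ∫ x, min 1 (Real.exp (-(ℓ i * x))) ∂(μ i)) ⟨i₀, by simpa using hi₀⟩
    simp only [Finset.mem_filter, Finset.mem_univ, true_and] at hi hmax
    exact ⟨_, integral_nonneg fun x => le_min zero_le_one (Real.exp_pos _).le,
      integral_min_one_exp_neg_lt_one (hpos i hi) (hℓ i hi).1, hmax⟩
  obtain ⟨J₁, hJ₁, hJ₁'⟩ : ∃ J₁ : ℝ, 0 < J₁ ∧ ∀ i, ¬ p i → ∫ x, x ∂(μ i) < -J₁ := by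
    by_cases hne : (Finset.univ.filter fun i => ¬ p i).Nonempty
    · obtain ⟨i, hi, hmax⟩ := Finset.exists_max_image _ (fun i => ∫ x, x ∂(μ i)) hne
      simp only [Finset.mem_filter, Finset.mem_univ, true_and] at hi hmax
      have := hneg i hi
      refine ⟨-(∫ x, x ∂(μ i)) / 2, by linarith, fun j hj => ?_⟩
      have := hmax j hj
      linarith
    · refine ⟨1, one_pos, fun i hi => absurd ⟨i, by simpa using hi⟩ hne⟩
  have hb : ∀ i, ∃ b : ℝ, 0 ≤ b ∧ (¬ p i → ∀ b' ≥ b, ∫ x, max x (-b') ∂(μ i) ≤ -J₁) := by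
    intro i
    by_cases h : p i
    · exact ⟨0, le_rfl, fun h' => absurd h h'⟩
    · obtain ⟨b, h1, h2⟩ := exists_integral_max_lt (hint i) (hJ₁' i h)
      exact ⟨b, h1, fun _ => h2⟩
  choose b₀ hb₀ hb using hb
  obtain ⟨b, hbb⟩ := Finite.exists_le b₀
  have hb0 : 0 ≤ b := (hb₀ 0).trans (hbb 0)
  obtain ⟨D, hD⟩ := Finite.exists_le d
  -- `J₁` concerns the unaffected units alone, so this constant is fixed before `J`; only the cap
  -- `c` on upward steps depends on `J`.
  refine ⟨1 / J₁, by positivity, fun J hJ hJlt => ?_⟩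
  have hc : ∀ i, ∃ c : ℝ, 0 ≤ c ∧ (p i → ∀ c' ≥ c, J ≤ ∫ x, min x c' ∂(μ i)) := by
    intro i
    by_cases h : p i
    · obtain ⟨c, h1, h2⟩ := exists_lt_integral_min (hint i) (hJlt i h)
      exact ⟨c, h1, fun _ => h2⟩
    · exact ⟨0, le_rfl, fun h' => absurd h' h⟩
  choose c₀ hc₀ hc using hc
  obtain ⟨c, hcc⟩ := Finite.exists_le c₀
  have hc0 : 0 ≤ c := (hc₀ 0).trans (hcc 0)
  have hq1' : 0 < 1 - q := by linarith
  -- The solution of κ = D b/J₁ + κ q: a failed attempt pays for at most `D` unaffected units and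
  -- then for a new attempt, whose failure is weighted by at most `q`.
  set κ := D * (b / J₁) / (1 - q) with hκ
  have hκ0 : 0 ≤ κ := by positivity
  have hκq : ∀ j, d j * (b / J₁) + κ * q ≤ κ := by
    intro j
    have h1 : κ * (1 - q) = D * (b / J₁) := by rw [hκ]; field_simp
    have h2 : (d j : ℝ) * (b / J₁) ≤ D * (b / J₁) := by
      gcongr
      exact hD j
    linarith
  refine ⟨c / J + κ, fun A hA => ⟨timeBound A c J b J₁ κ q ℓ d, measurable_timeBound,
    fun i y hy => ?_, fun i y hi => ?_, fun i y hi => ?_⟩⟩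
  · refine one_add_lintegral_timeBound_le (hint i) i hJ hJ₁ hA hc0 hb0 hκ0 hq0 hκq
      (fun h => hds i fun h' => h ((hd0 i).2 h')) (fun h => ?_) (fun h => ?_) hy
    · have hpi := (hd0 i).1 h
      exact ⟨hc i hpi c (hcc i), (hℓ i hpi).1, (hℓ i hpi).2.1, (hℓ i hpi).2.2, hq i hpi⟩
    · exact hb i (fun h' => h ((hd0 i).2 h')) b (hbb i)
  · have hdi := (hd0 i).2 hi
    by_cases hy : y ≤ 0
    · rw [timeBound_of_nonpos hy]
      have := hκq i
      rw [add_div]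
      linarith
    · have hy' := not_le.1 hy
      simp only [timeBound, hdi, if_true, hy, if_false]
      have h1 : Real.exp (-(ℓ i * y)) ≤ 1 :=
        Real.exp_le_one_iff.2 (by nlinarith [(hℓ i hi).1])
      have h2 : κ * Real.exp (-(ℓ i * y)) ≤ κ * 1 := by gcongr
      have h3 : (A + c - y) / J ≤ (A + c) / J := by gcongr; linarith
      rw [add_div] at h3
      linarith
  · have hdi : d i ≠ 0 := fun h => hi ((hd0 i).1 h)
    simp only [timeBound, hdi, if_false]
    have := hκq i
    rw [add_div, one_div, inv_mul_eq_div]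
    linarith

end Lyapunov

/-! ### Log-likelihood ratios of the units -/

section Units

variable {K : ℕ} {𝒳 : Fin K → Type*} [∀ k, MeasurableSpace (𝒳 k)]

lemma measurable_restrict_finset (E : Finset (Fin K)) :
    Measurable (E.restrict : (∀ k, 𝒳 k) → ∀ k : E, 𝒳 k) := by
  fun_prop

instance isProbabilityMeasure_localLaw (P : ProbabilityMeasure (∀ k, 𝒳 k)) (E : Finset (Fin K)) :
    IsProbabilityMeasure (localLaw P E) :=
  Measure.isProbabilityMeasure_map (measurable_restrict_finset E).aemeasurable

variable {m : ℕ} {𝒢 : Set (ProbabilityMeasure (∀ k, 𝒳 k))} {F G : ProbabilityMeasure (∀ k, 𝒳 k)}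
  {E : Finset (Fin K)}

lemma isProbabilityMeasure_of_mem_localFamily {Q : Measure (∀ k : E, 𝒳 k)}
    (hQ : Q ∈ localFamily 𝒢 F E) : IsProbabilityMeasure Q := by
  obtain ⟨⟨P, -, rfl⟩, -⟩ := hQ
  infer_instance

lemma localLaw_eq_of_notMem_affected (hE : E ∈ Finset.powersetCard m Finset.univ)
    (h : E ∉ affected m F G) : localLaw G E = localLaw F E := by
  classical
  by_contra hne
  exact h (by simp only [affected, Finset.mem_filter]; exact ⟨hE, hne⟩)

lemma localLaw_mem_localFamily (hG : G ∈ 𝒢) (h : E ∈ affected m F G) :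
    localLaw G E ∈ localFamily 𝒢 F E := by
  classical
  simp only [affected, Finset.mem_filter] at h
  exact ⟨⟨G, hG, rfl⟩, h.2⟩

lemma isProbabilityMeasure_mixture (hne : (localFamily 𝒢 F E).Nonempty)
    (hfin : (localFamily 𝒢 F E).Finite) : IsProbabilityMeasure (mixture 𝒢 F E) := by
  have := hfin.fintype
  refine ⟨?_⟩
  have h1 : ∀ Q : localFamily 𝒢 F E, Q.1 Set.univ = 1 := fun Q =>
    (isProbabilityMeasure_of_mem_localFamily Q.2).measure_univ
  rw [mixture, Measure.smul_apply, Measure.sum_apply _ MeasurableSet.univ, tsum_fintype]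
  simp only [h1, Finset.sum_const, Finset.card_univ, nsmul_eq_mul, mul_one, smul_eq_mul]
  rw [← Nat.card_eq_fintype_card, Nat.card_coe_set_eq]
  refine ENNReal.inv_mul_cancel ?_ (ENNReal.natCast_ne_top _)
  exact_mod_cast (Set.ncard_pos hfin).2 hne |>.ne'

/-- Since a post-change local law is dominated by a multiple of the mixture, integrability under the
mixture passes to it; this is how exp(-ξ) becomes integrable after the change. -/
lemma le_ncard_smul_mixture (hfin : (localFamily 𝒢 F E).Finite) {Q : Measure (∀ k : E, 𝒳 k)}
    (hQ : Q ∈ localFamily 𝒢 F E) :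
    Q ≤ ((localFamily 𝒢 F E).ncard : ℝ≥0∞) • mixture 𝒢 F E := by
  rw [mixture, smul_smul, ENNReal.mul_inv_cancel ?_ (ENNReal.natCast_ne_top _), one_smul]
  · exact Measure.le_sum (fun Q : localFamily 𝒢 F E => Q.1) ⟨Q, hQ⟩
  · exact_mod_cast ((Set.ncard_pos hfin).2 ⟨Q, hQ⟩).ne'

lemma ac_of_mem_localFamily (hac : ∀ P ∈ 𝒢, ∀ E ∈ affected m F P,
      localLaw P E ≪ localLaw F E ∧ localLaw F E ≪ localLaw P E)
    (hE : E ∈ Finset.powersetCard m Finset.univ) {Q : Measure (∀ k : E, 𝒳 k)}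
    (hQ : Q ∈ localFamily 𝒢 F E) : Q ≪ localLaw F E ∧ localLaw F E ≪ Q := by
  classical
  obtain ⟨⟨P, hP, rfl⟩, hne⟩ := hQ
  exact hac P hP E (by simp only [affected, Finset.mem_filter]; exact ⟨hE, hne⟩)

lemma mixture_ac (hac : ∀ P ∈ 𝒢, ∀ E ∈ affected m F P,
      localLaw P E ≪ localLaw F E ∧ localLaw F E ≪ localLaw P E)
    (hE : E ∈ Finset.powersetCard m Finset.univ) (hne : (localFamily 𝒢 F E).Nonempty)
    (hfin : (localFamily 𝒢 F E).Finite) :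
    mixture 𝒢 F E ≪ localLaw F E ∧ localLaw F E ≪ mixture 𝒢 F E := by
  constructor
  · refine Measure.AbsolutelyContinuous.smul_left ?_ _
    exact Measure.absolutelyContinuous_sum_left fun Q => (ac_of_mem_localFamily hac hE Q.2).1
  · obtain ⟨Q, hQ⟩ := hne
    refine (ac_of_mem_localFamily hac hE hQ).2.trans ?_
    exact (Measure.absolutelyContinuous_of_le (le_ncard_smul_mixture hfin hQ)).trans
      (Measure.smul_absolutelyContinuous)

lemma measurable_xi : Measurable (xi 𝒢 F E) := measurable_llr _ _

/-- The law of `ξ^E` when the sample has the global distribution `P`. -/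
noncomputable def xiLaw (𝒢 : Set (ProbabilityMeasure (∀ k, 𝒳 k)))
    (F P : ProbabilityMeasure (∀ k, 𝒳 k)) (E : Finset (Fin K)) : Measure ℝ :=
  (localLaw P E).map (xi 𝒢 F E)

instance isProbabilityMeasure_xiLaw (P : ProbabilityMeasure (∀ k, 𝒳 k)) :
    IsProbabilityMeasure (xiLaw 𝒢 F P E) :=
  Measure.isProbabilityMeasure_map measurable_xi.aemeasurable

lemma lintegral_xiLaw (P : ProbabilityMeasure (∀ k, 𝒳 k)) {f : ℝ → ℝ≥0∞} (hf : Measurable f) :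
    ∫⁻ x, f (xi 𝒢 F E (E.restrict x)) ∂(P : Measure (∀ k, 𝒳 k)) = ∫⁻ y, f y ∂(xiLaw 𝒢 F P E) := by
  rw [xiLaw, localLaw, lintegral_map hf measurable_xi,
    lintegral_map (show Measurable fun a => f (xi 𝒢 F E a) from hf.comp measurable_xi)
      (measurable_restrict_finset E)]

lemma integral_exp_xiLaw_pre (hac : ∀ P ∈ 𝒢, ∀ E ∈ affected m F P,
      localLaw P E ≪ localLaw F E ∧ localLaw F E ≪ localLaw P E)
    (hE : E ∈ Finset.powersetCard m Finset.univ) (hne : (localFamily 𝒢 F E).Nonempty)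
    (hfin : (localFamily 𝒢 F E).Finite) :
    Integrable Real.exp (xiLaw 𝒢 F F E) ∧ ∫ x, Real.exp x ∂(xiLaw 𝒢 F F E) = 1 := by
  have := isProbabilityMeasure_mixture hne hfin
  obtain ⟨h1, h2⟩ := mixture_ac hac hE hne hfin
  have he := exp_llr_of_ac' (mixture 𝒢 F E) (localLaw F E) h2
  constructor
  · rw [xiLaw, integrable_map_measure (by fun_prop) measurable_xi.aemeasurable]
    exact (integrable_congr he).2 Measure.integrable_toReal_rnDeriv
  · rw [xiLaw, integral_map measurable_xi.aemeasurable (by fun_prop)]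
    refine (integral_congr_ae he).trans ?_
    rw [Measure.integral_toReal_rnDeriv h1]
    simp

lemma integral_xiLaw_pre_neg (hac : ∀ P ∈ 𝒢, ∀ E ∈ affected m F P,
      localLaw P E ≪ localLaw F E ∧ localLaw F E ≪ localLaw P E)
    (hE : E ∈ Finset.powersetCard m Finset.univ) (hne : (localFamily 𝒢 F E).Nonempty)
    (hfin : (localFamily 𝒢 F E).Finite)
    (hpre : Integrable (llr (localLaw F E) (mixture 𝒢 F E)) (localLaw F E) ∧
      0 < driftPre 𝒢 F E) :
    Integrable (fun x => x) (xiLaw 𝒢 F F E) ∧ ∫ x, x ∂(xiLaw 𝒢 F F E) < 0 := by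
  have := isProbabilityMeasure_mixture hne hfin
  obtain ⟨h1, h2⟩ := mixture_ac hac hE hne hfin
  have he : (fun x => -llr (localLaw F E) (mixture 𝒢 F E) x) =ᵐ[localLaw F E] xi 𝒢 F E :=
    neg_llr h2
  constructor
  · rw [xiLaw, integrable_map_measure (by fun_prop) measurable_xi.aemeasurable]
    exact (integrable_congr he).1 hpre.1.neg
  · rw [xiLaw, integral_map measurable_xi.aemeasurable (by fun_prop), ← integral_congr_ae he,
      integral_neg]
    exact neg_lt_zero.2 hpre.2

lemma integral_xiLaw_post (hint : Integrable (xi 𝒢 F E) (localLaw G E)) :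
    Integrable (fun x => x) (xiLaw 𝒢 F G E) ∧
      ∫ x, x ∂(xiLaw 𝒢 F G E) = driftPost 𝒢 F G E := by
  constructor
  · rw [xiLaw, integrable_map_measure (by fun_prop) measurable_xi.aemeasurable]
    exact hint
  · rw [xiLaw, integral_map measurable_xi.aemeasurable (by fun_prop)]
    rfl

lemma integrable_exp_neg_xiLaw_post (hac : ∀ P ∈ 𝒢, ∀ E ∈ affected m F P,
      localLaw P E ≪ localLaw F E ∧ localLaw F E ≪ localLaw P E)
    (hE : E ∈ Finset.powersetCard m Finset.univ) (hfin : (localFamily 𝒢 F E).Finite)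
    (hG : localLaw G E ∈ localFamily 𝒢 F E) :
    Integrable (fun x => Real.exp (-x)) (xiLaw 𝒢 F G E) := by
  have := isProbabilityMeasure_mixture ⟨_, hG⟩ hfin
  obtain ⟨h1, h2⟩ := mixture_ac hac hE ⟨_, hG⟩ hfin
  have he := exp_neg_llr h1
  rw [xiLaw, integrable_map_measure (by fun_prop) measurable_xi.aemeasurable]
  have hi : Integrable (fun x => Real.exp (-xi 𝒢 F E x)) (mixture 𝒢 F E) :=
    (integrable_congr he).2 Measure.integrable_toReal_rnDeriv
  exact (hi.smul_measure (ENNReal.natCast_ne_top _)).mono_measure (le_ncard_smul_mixture hfin hG)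

lemma xiLaw_eq_of_localLaw_eq {P Q : ProbabilityMeasure (∀ k, 𝒳 k)}
    (h : localLaw P E = localLaw Q E) : xiLaw 𝒢 F P E = xiLaw 𝒢 F Q E := by
  rw [xiLaw, xiLaw, h]

end Units

/-! ### Past of the path and integration of the next coordinate -/

section Past

variable {K : ℕ} {𝒳 : Fin K → Type*} [∀ k, MeasurableSpace (𝒳 k)]

/-- The σ-algebra generated by the first `n` coordinates of the path. -/
abbrev past (𝒳 : Fin K → Type*) [∀ k, MeasurableSpace (𝒳 k)] (n : ℕ) :
    MeasurableSpace (ℕ → ∀ k, 𝒳 k) :=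
  ⨆ i ∈ Set.Iio n, MeasurableSpace.comap (fun ω => ω i) inferInstance

lemma past_mono {n k : ℕ} (h : n ≤ k) : past 𝒳 n ≤ past 𝒳 k :=
  biSup_mono fun _ hi => lt_of_lt_of_le hi h

lemma past_le (n : ℕ) : past 𝒳 n ≤ MeasurableSpace.pi :=
  iSup₂_le fun i _ => (measurable_pi_apply i).comap_le

lemma measurable_eval_past {i n : ℕ} (h : i < n) :
    Measurable[past 𝒳 n] fun ω : ℕ → ∀ k, 𝒳 k => ω i :=
  Measurable.mono (comap_measurable _)
    (le_iSup₂_of_le (f := fun (i : ℕ) (_ : i ∈ Set.Iio n) =>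
      MeasurableSpace.comap (fun ω : ℕ → ∀ k, 𝒳 k => ω i) inferInstance) i h le_rfl) le_rfl

variable {F G : ProbabilityMeasure (∀ k, 𝒳 k)} {ν : ℕ}

instance isProbabilityMeasure_changeLaw : IsProbabilityMeasure (changeLaw F G ν) := by
  unfold changeLaw; infer_instance

lemma indepFun_past {β : Type*} [MeasurableSpace β] {n : ℕ} {Z : (ℕ → ∀ k, 𝒳 k) → β}
    (hZ : Measurable[past 𝒳 n] Z) : IndepFun Z (fun ω => ω n) (changeLaw F G ν) := by
  have hind : iIndepFun (fun (i : ℕ) (ω : ℕ → ∀ k, 𝒳 k) => ω i) (changeLaw F G ν) :=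
    iIndepFun_infinitePi (X := fun _ x => x) fun _ => measurable_id
  have h := indep_iSup_of_disjoint (fun i => (measurable_pi_apply i).comap_le) hind.iIndep
    (S := Set.Iio n) (T := {n}) (by simp)
  rw [IndepFun_iff_Indep]
  refine indep_of_indep_of_le_left (indep_of_indep_of_le_right h ?_) hZ.comap_le
  simp

/-- The coordinate at time `n` can be integrated out given the coordinates before it. -/
lemma lintegral_changeLaw_past {β : Type*} [MeasurableSpace β] {n : ℕ}
    {Z : (ℕ → ∀ k, 𝒳 k) → β} (hZ : Measurable[past 𝒳 n] Z) {f : β → (∀ k, 𝒳 k) → ℝ≥0∞}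
    (hf : Measurable (Function.uncurry f)) :
    ∫⁻ ω, f (Z ω) (ω n) ∂(changeLaw F G ν) = ∫⁻ ω, ∫⁻ x, f (Z ω) x
      ∂((if n < ν then F else G : ProbabilityMeasure (∀ k, 𝒳 k)) : Measure (∀ k, 𝒳 k))
      ∂(changeLaw F G ν) := by
  have hZ' : Measurable Z := hZ.mono (past_le n) le_rfl
  have hn : Measurable fun ω : ℕ → ∀ k, 𝒳 k => ω n := measurable_pi_apply n
  have hmap : (changeLaw F G ν).map (fun ω => ω n) =
      ((if n < ν then F else G : ProbabilityMeasure (∀ k, 𝒳 k)) : Measure (∀ k, 𝒳 k)) :=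
    Measure.infinitePi_map_eval _ n
  have hprod := (indepFun_iff_map_prod_eq_prod_map_map hZ'.aemeasurable hn.aemeasurable).1
    (indepFun_past (F := F) (G := G) (ν := ν) hZ)
  calc ∫⁻ ω, f (Z ω) (ω n) ∂(changeLaw F G ν)
      = ∫⁻ p, Function.uncurry f p ∂((changeLaw F G ν).map fun ω => (Z ω, ω n)) := by
        rw [lintegral_map hf (hZ'.prodMk hn)]; rfl
    _ = ∫⁻ z, ∫⁻ x, f z x ∂((changeLaw F G ν).map fun ω => ω n)
          ∂((changeLaw F G ν).map Z) := by
        have : IsProbabilityMeasure ((changeLaw F G ν).map fun ω => ω n) := by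
          rw [hmap]; infer_instance
        rw [hprod, lintegral_prod _ hf.aemeasurable]; rfl
    _ = _ := by
        rw [hmap, lintegral_map hf.lintegral_prod_right hZ']

end Past

/-! ### The policy as a Markov chain and its drift inequality -/

section Policy

variable {K : ℕ} {𝒳 : Fin K → Type*} [∀ k, MeasurableSpace (𝒳 k)]
  {𝒢 : Set (ProbabilityMeasure (∀ k, 𝒳 k))} {F G : ProbabilityMeasure (∀ k, 𝒳 k)}
  {U : Finset (Finset (Fin K))} {L : ℕ} {e : Fin L ≃ U}

lemma measurable_unit_xi :
    Measurable fun p : (ℝ × Fin L) × (∀ k, 𝒳 k) =>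
      xi 𝒢 F (e p.1.2).1 ((e p.1.2).1.restrict p.2) := by
  have h : ∀ g : Fin L → (∀ k, 𝒳 k) → ℝ, (∀ i, Measurable (g i)) →
      Measurable fun p : (ℝ × Fin L) × (∀ k, 𝒳 k) => g p.1.2 p.2 := by
    intro g hg
    have : Measurable fun p : (∀ k, 𝒳 k) × Fin L => g p.2 p.1 :=
      measurable_from_prod_countable_left hg
    exact this.comp (measurable_snd.prodMk measurable_fst.snd)
  exact h (fun i x => xi 𝒢 F (e i).1 ((e i).1.restrict x)) fun i =>
    measurable_xi.comp (measurable_restrict_finset _)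

variable [NeZero L]

lemma measurable_step :
    Measurable fun p : (ℝ × Fin L) × (∀ k, 𝒳 k) => step 𝒢 F e p.2 p.1 := by
  have hY : Measurable fun p : (ℝ × Fin L) × (∀ k, 𝒳 k) =>
      max p.1.1 0 + xi 𝒢 F (e p.1.2).1 ((e p.1.2).1.restrict p.2) :=
    (measurable_fst.fst.max measurable_const).add measurable_unit_xi
  refine hY.prodMk (Measurable.ite (measurableSet_le hY measurable_const) ?_ measurable_fst.snd)
  exact (measurable_of_countable fun i : Fin L => i + 1).comp measurable_fst.snd

lemma measurable_state_past (n : ℕ) :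
    Measurable[past 𝒳 n] fun ω => state 𝒢 F e ω n := by
  induction n with
  | zero => exact measurable_const
  | succ n ih =>
    have h1 : Measurable[past 𝒳 (n + 1)] fun ω => state 𝒢 F e ω n :=
      ih.mono (past_mono n.le_succ) le_rfl
    have h2 : Measurable[past 𝒳 (n + 1)] fun ω : ℕ → ∀ k, 𝒳 k => ω n :=
      measurable_eval_past n.lt_succ_self
    exact measurable_step.comp (h1.prodMk h2)

lemma lt_alarm_iff {A : ℝ} {ω : ℕ → ∀ k, 𝒳 k} {n : ℕ} :
    (n : ℕ∞) < alarm 𝒢 F e A ω ↔ ∀ k, 1 ≤ k → k ≤ n → (state 𝒢 F e ω k).1 < A := by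
  rw [← ENat.add_one_le_iff (ENat.natCast_ne_top n), alarm, le_iInf₂_iff]
  constructor
  · intro h k hk1 hkn
    by_contra! hA
    have := h k ⟨hk1, hA⟩
    have : n + 1 ≤ k := by exact_mod_cast this
    omega
  · intro h k hk
    by_contra! hlt
    have hlt' : k < n + 1 := by exact_mod_cast hlt
    exact (h k hk.1 (by omega)).not_ge hk.2

lemma measurableSet_lt_alarm {A : ℝ} (n : ℕ) :
    MeasurableSet[past 𝒳 n] {ω : ℕ → ∀ k, 𝒳 k | (n : ℕ∞) < alarm 𝒢 F e A ω} := by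
  simp only [lt_alarm_iff, Set.ofPred_forall]
  refine MeasurableSet.iInter fun k => MeasurableSet.iInter fun _ => MeasurableSet.iInter fun hk => ?_
  have h : Measurable[past 𝒳 n] fun ω => (state 𝒢 F e ω k).1 :=
    measurable_fst.comp ((measurable_state_past k).mono (past_mono hk) le_rfl)
  exact h measurableSet_Iio

lemma state_lt_of_lt_alarm {A : ℝ} (hA : 0 < A) {ω : ℕ → ∀ k, 𝒳 k} {n : ℕ}
    (h : (n : ℕ∞) < alarm 𝒢 F e A ω) : (state 𝒢 F e ω n).1 < A := by
  rcases Nat.eq_zero_or_pos n with rfl | hn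
  · exact hA
  · exact lt_alarm_iff.1 h n hn le_rfl

lemma succ_lt_alarm_iff {A : ℝ} {ω : ℕ → ∀ k, 𝒳 k} {n : ℕ} :
    ((n + 1 : ℕ) : ℕ∞) < alarm 𝒢 F e A ω ↔
      (n : ℕ∞) < alarm 𝒢 F e A ω ∧ (state 𝒢 F e ω (n + 1)).1 < A := by
  simp only [lt_alarm_iff]
  constructor
  · exact fun h => ⟨fun k h1 h2 => h k h1 (by omega), h _ (by omega) le_rfl⟩
  · rintro ⟨h1, h2⟩ k hk1 hk2
    rcases Nat.le_succ_iff.1 hk2 with h | rfl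
    · exact h1 k hk1 h
    · exact h2

/-- The remaining time is a count of alarm-free instants, so its mean is a sum of survival
probabilities to which the drift inequality can be telescoped. -/
lemma coe_enat_sub_eq_tsum (t : ℕ∞) (ν : ℕ) :
    ((t - (ν : ℕ∞) : ℕ∞) : ℝ≥0∞) = ∑' k : ℕ, if ((ν + k : ℕ) : ℕ∞) < t then 1 else 0 := by
  induction t with
  | top =>
    have h : ∀ k : ℕ, ((ν + k : ℕ) : ℕ∞) < ⊤ := fun k => ENat.natCast_lt_top _
    simp only [h, if_true]
    rw [ENNReal.tsum_const_eq_top_of_ne_zero one_ne_zero]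
    simp
  | coe n =>
    rw [tsum_eq_sum (s := Finset.range (n - ν))]
    · rw [Finset.sum_congr rfl (g := fun _ => (1 : ℝ≥0∞))]
      · rw [Finset.sum_const, Finset.card_range, ← ENat.natCast_sub]
        simp
      · intro k hk
        rw [Finset.mem_range] at hk
        rw [if_pos (by exact_mod_cast (by omega : ν + k < n))]
    · intro k hk
      rw [Finset.mem_range] at hk
      rw [if_neg]
      intro h
      have : ν + k < n := by exact_mod_cast h
      omega

variable {ν : ℕ} {A : ℝ}

/-- The one-step drift inequality along the path, after the change. -/
lemma lintegral_lt_alarm_succ_le {h : ℝ → Fin L → ℝ} (hA : 0 < A)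
    (hmeas : ∀ i, Measurable fun y => h y i)
    (hstep : ∀ i, ∀ y < A, 1 + ∫⁻ x, (if max y 0 + x < A then ENNReal.ofReal (h (max y 0 + x)
      (if max y 0 + x ≤ 0 then i + 1 else i)) else 0) ∂(xiLaw 𝒢 F G (e i).1) ≤
        ENNReal.ofReal (h y i))
    {n : ℕ} (hn : ν ≤ n) {B : Set (ℕ → ∀ k, 𝒳 k)} (hB : MeasurableSet[past 𝒳 n] B) :
    changeLaw F G ν (B ∩ {ω | (n : ℕ∞) < alarm 𝒢 F e A ω}) +
      ∫⁻ ω in B ∩ {ω | ((n + 1 : ℕ) : ℕ∞) < alarm 𝒢 F e A ω},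
        ENNReal.ofReal (h (state 𝒢 F e ω (n + 1)).1 (state 𝒢 F e ω (n + 1)).2)
          ∂(changeLaw F G ν) ≤
      ∫⁻ ω in B ∩ {ω | (n : ℕ∞) < alarm 𝒢 F e A ω},
        ENNReal.ofReal (h (state 𝒢 F e ω n).1 (state 𝒢 F e ω n).2) ∂(changeLaw F G ν) := by
  set S : ℕ → Set (ℕ → ∀ k, 𝒳 k) := fun n => B ∩ {ω | (n : ℕ∞) < alarm 𝒢 F e A ω} with hS
  have hSp : MeasurableSet[past 𝒳 n] (S n) := hB.inter (measurableSet_lt_alarm n)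
  have hSm : MeasurableSet (S n) := past_le n _ hSp
  have hSm' : MeasurableSet (S (n + 1)) :=
    (past_le n _ hB).inter (past_le (n + 1) _ (measurableSet_lt_alarm (n + 1)))
  have hmeas' : Measurable fun s : ℝ × Fin L => ENNReal.ofReal (h s.1 s.2) :=
    ENNReal.measurable_ofReal.comp (measurable_from_prod_countable_left hmeas)
  -- The second coordinate of `z` carries the indicator of the past event, so that one application
  -- of the independence formula handles the state and the event together.
  set f : (ℝ × Fin L) × ℝ≥0∞ → (∀ k, 𝒳 k) → ℝ≥0∞ := fun z x =>
    z.2 * (if (step 𝒢 F e x z.1).1 < A then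
      ENNReal.ofReal (h (step 𝒢 F e x z.1).1 (step 𝒢 F e x z.1).2) else 0) with hf
  have hfm : Measurable (Function.uncurry f) := by
    have hs : Measurable fun p : ((ℝ × Fin L) × ℝ≥0∞) × (∀ k, 𝒳 k) => step 𝒢 F e p.2 p.1.1 :=
      measurable_step.comp (by fun_prop :
        Measurable fun p : ((ℝ × Fin L) × ℝ≥0∞) × (∀ k, 𝒳 k) => (p.1.1, p.2))
    exact measurable_fst.snd.mul (Measurable.ite (hs.fst measurableSet_Iio) (hmeas'.comp hs)
      measurable_const)
  have hZ : Measurable[past 𝒳 n] fun ω =>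
      (state 𝒢 F e ω n, (S n).indicator (1 : (ℕ → ∀ k, 𝒳 k) → ℝ≥0∞) ω) :=
    (measurable_state_past n).prodMk (measurable_const.indicator hSp)
  have key := lintegral_changeLaw_past (F := F) (G := G) (ν := ν) hZ hfm
  rw [if_neg (by omega)] at key
  have h1 : ∫⁻ ω in S (n + 1),
      ENNReal.ofReal (h (state 𝒢 F e ω (n + 1)).1 (state 𝒢 F e ω (n + 1)).2) ∂(changeLaw F G ν) =
      ∫⁻ ω, f (state 𝒢 F e ω n, (S n).indicator 1 ω) (ω n) ∂(changeLaw F G ν) := by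
    rw [← lintegral_indicator hSm']
    refine lintegral_congr fun ω => ?_
    have hmem : ω ∈ S (n + 1) ↔ ω ∈ S n ∧ (state 𝒢 F e ω (n + 1)).1 < A := by
      simp only [hS, Set.mem_inter_iff, Set.mem_ofPred_eq, succ_lt_alarm_iff, and_assoc]
    by_cases hω : ω ∈ S n
    · by_cases hlt : (state 𝒢 F e ω (n + 1)).1 < A
      · rw [Set.indicator_of_mem (hmem.2 ⟨hω, hlt⟩)]
        simp only [hf, Set.indicator_of_mem hω, Pi.one_apply, one_mul]
        exact (if_pos hlt).symm
      · rw [Set.indicator_of_notMem fun h' => hlt (hmem.1 h').2]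
        exact ((congrArg _ (if_neg hlt)).trans (mul_zero _)).symm
    · rw [Set.indicator_of_notMem fun h' => hω (hmem.1 h').1]
      simp [hf, Set.indicator_of_notMem hω]
  change changeLaw F G ν (S n) + ∫⁻ ω in S (n + 1), _ ∂(changeLaw F G ν) ≤ ∫⁻ ω in S n, _ ∂_
  rw [h1, key, ← lintegral_indicator_one hSm, ← lintegral_add_left (measurable_one.indicator hSm),
    ← lintegral_indicator hSm]
  refine lintegral_mono fun ω => ?_
  by_cases hω : ω ∈ S n
  · have hlt := state_lt_of_lt_alarm hA hω.2
    simp only [Set.indicator_of_mem hω, Pi.one_apply, hf, one_mul]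
    refine le_trans (le_of_eq ?_) (hstep (state 𝒢 F e ω n).2 (state 𝒢 F e ω n).1 hlt)
    congr 1
    rw [← lintegral_xiLaw]
    · rfl
    · have hm : Measurable fun x : ℝ => max (state 𝒢 F e ω n).1 0 + x := by fun_prop
      refine Measurable.ite (hm measurableSet_Iio) ?_ measurable_const
      refine hmeas'.comp (hm.prodMk (Measurable.ite (hm measurableSet_Iic) measurable_const
        measurable_const))
  · simp [hf, Set.indicator_of_notMem hω]

/-- The mean remaining time to alarm is at most the supersolution at the current state. -/
lemma lintegral_alarm_sub_le {h : ℝ → Fin L → ℝ} (hA : 0 < A)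
    (hmeas : ∀ i, Measurable fun y => h y i)
    (hstep : ∀ i, ∀ y < A, 1 + ∫⁻ x, (if max y 0 + x < A then ENNReal.ofReal (h (max y 0 + x)
      (if max y 0 + x ≤ 0 then i + 1 else i)) else 0) ∂(xiLaw 𝒢 F G (e i).1) ≤
        ENNReal.ofReal (h y i))
    {B : Set (ℕ → ∀ k, 𝒳 k)} (hB : MeasurableSet[past 𝒳 ν] B) :
    ∫⁻ ω in B, ((alarm 𝒢 F e A ω - (ν : ℕ∞) : ℕ∞) : ℝ≥0∞) ∂(changeLaw F G ν) ≤
      ∫⁻ ω in B ∩ {ω | (ν : ℕ∞) < alarm 𝒢 F e A ω},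
        ENNReal.ofReal (h (state 𝒢 F e ω ν).1 (state 𝒢 F e ω ν).2) ∂(changeLaw F G ν) := by
  set a : ℕ → ℝ≥0∞ := fun k =>
    changeLaw F G ν (B ∩ {ω | ((ν + k : ℕ) : ℕ∞) < alarm 𝒢 F e A ω}) with ha
  set b : ℕ → ℝ≥0∞ := fun k => ∫⁻ ω in B ∩ {ω | ((ν + k : ℕ) : ℕ∞) < alarm 𝒢 F e A ω},
    ENNReal.ofReal (h (state 𝒢 F e ω (ν + k)).1 (state 𝒢 F e ω (ν + k)).2) ∂(changeLaw F G ν)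
    with hb
  have hab : ∀ k, a k + b (k + 1) ≤ b k := fun k =>
    lintegral_lt_alarm_succ_le hA hmeas hstep (Nat.le_add_right ν k)
      (past_mono (Nat.le_add_right ν k) _ hB)
  have hsum : ∀ n, ∑ k ∈ Finset.range n, a k + b n ≤ b 0 := by
    intro n
    induction n with
    | zero => simp
    | succ n ih =>
      rw [Finset.sum_range_succ, add_assoc]
      exact (add_le_add_right (hab n) _).trans ih
  have hmS : ∀ k, MeasurableSet {ω : ℕ → ∀ k, 𝒳 k | ((ν + k : ℕ) : ℕ∞) < alarm 𝒢 F e A ω} :=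
    fun k => past_le _ _ (measurableSet_lt_alarm (ν + k))
  have hint : ∫⁻ ω in B, ((alarm 𝒢 F e A ω - (ν : ℕ∞) : ℕ∞) : ℝ≥0∞) ∂(changeLaw F G ν) =
      ∑' k, a k := by
    simp_rw [coe_enat_sub_eq_tsum]
    rw [lintegral_tsum fun k => (Measurable.ite (hmS k) measurable_const
      measurable_const).aemeasurable]
    refine tsum_congr fun k => ?_
    have : (fun ω => if ((ν + k : ℕ) : ℕ∞) < alarm 𝒢 F e A ω then (1 : ℝ≥0∞) else 0) =
        Set.indicator {ω | ((ν + k : ℕ) : ℕ∞) < alarm 𝒢 F e A ω} 1 := by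
      ext ω; simp [Set.indicator_apply]
    rw [this, lintegral_indicator_one (hmS k), Measure.restrict_apply (hmS k), Set.inter_comm]
  rw [hint]
  exact ENNReal.tsum_le_of_sum_range_le fun n => le_self_add.trans (hsum n)

end Policy

/-! ### Excursions before the change and the restricted history -/

lemma measurable_stripStep {μ : Measure ℝ} [SFinite μ] {A : ℝ} {f : ℝ → ℝ≥0∞} (hf : Measurable f) :
    Measurable (stripStep μ A f) := by
  refine Measurable.lintegral_prod_right'
    (f := fun p : ℝ × ℝ => (Set.Ioo 0 A).indicator f (p.1 + p.2)) ?_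
  exact (hf.indicator measurableSet_Ioo).comp (measurable_fst.add measurable_snd)

section Excursion

variable {K : ℕ} {𝒳 : Fin K → Type*} [∀ k, MeasurableSpace (𝒳 k)]
  {𝒢 : Set (ProbabilityMeasure (∀ k, 𝒳 k))} {F G : ProbabilityMeasure (∀ k, 𝒳 k)}
  {U : Finset (Finset (Fin K))} {L : ℕ} [NeZero L] {e : Fin L ≃ U} {m : ℕ}

/-- No alarm up to time `n`, and the statistic was last non-positive at time `s`, when the policy
moved to the unit at position `i`. -/
def excursion (𝒢 : Set (ProbabilityMeasure (∀ k, 𝒳 k))) (F : ProbabilityMeasure (∀ k, 𝒳 k))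
    (e : Fin L ≃ U) (A : ℝ) (s : ℕ) (i : Fin L) (n : ℕ) : Set (ℕ → ∀ k, 𝒳 k) :=
  {ω | (s : ℕ∞) < alarm 𝒢 F e A ω ∧ (state 𝒢 F e ω s).2 = i ∧ (state 𝒢 F e ω s).1 ≤ 0 ∧
    ∀ t, s < t → t ≤ n → (state 𝒢 F e ω t).1 ∈ Set.Ioo 0 A}

variable {A : ℝ} {s n ν : ℕ} {i : Fin L} {ω : ℕ → ∀ k, 𝒳 k}

lemma state_succ_snd (h : 0 < (state 𝒢 F e ω (n + 1)).1) :
    (state 𝒢 F e ω (n + 1)).2 = (state 𝒢 F e ω n).2 :=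
  if_neg (not_le.2 h)

lemma state_snd_of_mem_excursion (hω : ω ∈ excursion 𝒢 F e A s i n) {t : ℕ} (hst : s ≤ t)
    (htn : t ≤ n) : (state 𝒢 F e ω t).2 = i := by
  induction t, hst using Nat.le_induction with
  | base => exact hω.2.1
  | succ t hst ih =>
    rw [state_succ_snd (hω.2.2.2 (t + 1) (by omega) htn).1, ih (by omega)]

lemma mem_excursion_succ (hsn : s ≤ n) : ω ∈ excursion 𝒢 F e A s i (n + 1) ↔
    ω ∈ excursion 𝒢 F e A s i n ∧ (state 𝒢 F e ω (n + 1)).1 ∈ Set.Ioo 0 A := by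
  constructor
  · rintro ⟨h1, h2, h3, h4⟩
    exact ⟨⟨h1, h2, h3, fun t ht htn => h4 t ht (by omega)⟩, h4 _ (by omega) le_rfl⟩
  · rintro ⟨⟨h1, h2, h3, h4⟩, h5⟩
    refine ⟨h1, h2, h3, fun t ht htn => ?_⟩
    rcases Nat.le_succ_iff.1 htn with h | rfl
    · exact h4 t ht h
    · exact h5

lemma measurableSet_excursion (hsn : s ≤ n) :
    MeasurableSet[past 𝒳 n] (excursion 𝒢 F e A s i n) := by
  have hm : ∀ t ≤ n, Measurable[past 𝒳 n] fun ω => state 𝒢 F e ω t := fun t ht =>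
    (measurable_state_past t).mono (past_mono ht) le_rfl
  have h1 : ∀ t ≤ n, Measurable[past 𝒳 n] fun ω => (state 𝒢 F e ω t).1 := fun t ht =>
    measurable_fst.comp (hm t ht)
  have h2 : Measurable[past 𝒳 n] fun ω => (state 𝒢 F e ω s).2 := measurable_snd.comp (hm s hsn)
  have h4 : MeasurableSet[past 𝒳 n]
      {ω | ∀ t, s < t → t ≤ n → (state 𝒢 F e ω t).1 ∈ Set.Ioo 0 A} := by
    simp only [Set.ofPred_forall]
    exact MeasurableSet.iInter fun t => MeasurableSet.iInter fun _ => MeasurableSet.iInter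
      fun ht => h1 t ht measurableSet_Ioo
  exact (past_mono hsn _ (measurableSet_lt_alarm s)).inter
    ((h2 (measurableSet_singleton i)).inter ((h1 s hsn measurableSet_Iic).inter h4))

lemma lt_alarm_of_mem_excursion (hω : ω ∈ excursion 𝒢 F e A s i n) :
    (n : ℕ∞) < alarm 𝒢 F e A ω := by
  rw [lt_alarm_iff]
  intro k hk1 hkn
  rcases le_or_gt k s with h | h
  · exact lt_alarm_iff.1 hω.1 k hk1 h
  · exact (hω.2.2.2 k h hkn).2

lemma exists_mem_excursion (hω : (n : ℕ∞) < alarm 𝒢 F e A ω) :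
    ∃ s ≤ n, ω ∈ excursion 𝒢 F e A s (state 𝒢 F e ω n).2 n := by
  classical
  set s := Nat.findGreatest (fun t => (state 𝒢 F e ω t).1 ≤ 0) n with hs
  have hsn : s ≤ n := Nat.findGreatest_le n
  -- The default value 0 of `Nat.findGreatest` is legitimate because the statistic starts at 0,
  -- which counts as non-positive.
  have hs0 : (state 𝒢 F e ω s).1 ≤ 0 :=
    Nat.findGreatest_spec (P := fun t => (state 𝒢 F e ω t).1 ≤ 0) (Nat.zero_le n) le_rfl
  have hlt := lt_alarm_iff.1 hω
  have hmem : ω ∈ excursion 𝒢 F e A s (state 𝒢 F e ω s).2 n := by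
    refine ⟨lt_alarm_iff.2 fun k h1 h2 => hlt k h1 (h2.trans hsn), rfl, hs0, fun t ht htn => ⟨?_, ?_⟩⟩
    · exact not_le.1 (Nat.findGreatest_is_greatest ht htn)
    · exact hlt t (by omega) htn
  refine ⟨s, hsn, ?_⟩
  rwa [state_snd_of_mem_excursion hmem hsn le_rfl]

/-- During an excursion that ends before the change the statistic is a killed random walk. -/
lemma lintegral_excursion {D : Set (ℕ → ∀ k, 𝒳 k)} (hD : MeasurableSet[past 𝒳 s] D) (k : ℕ)
    (hk : s + k ≤ ν) {f : ℝ → ℝ≥0∞} (hf : Measurable f) :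
    ∫⁻ ω in D ∩ excursion 𝒢 F e A s i (s + k), f (max (state 𝒢 F e ω (s + k)).1 0)
      ∂(changeLaw F G ν) =
      (stripStep (xiLaw 𝒢 F F (e i).1) A)^[k] f 0 *
        changeLaw F G ν (D ∩ excursion 𝒢 F e A s i s) := by
  have hR : ∀ k, MeasurableSet[past 𝒳 (s + k)] (D ∩ excursion 𝒢 F e A s i (s + k)) := fun k =>
    (past_mono (Nat.le_add_right s k) _ hD).inter (measurableSet_excursion (Nat.le_add_right s k))
  have hRm : ∀ k, MeasurableSet (D ∩ excursion 𝒢 F e A s i (s + k)) := fun k => past_le _ _ (hR k)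
  induction k generalizing f with
  | zero =>
    rw [Nat.add_zero, Function.iterate_zero, id, ← setLIntegral_const]
    refine setLIntegral_congr_fun (hRm 0) fun ω hω => ?_
    exact congrArg f (max_eq_right hω.2.2.2.1)
  | succ k ih =>
    rw [Function.iterate_succ_apply, ← ih (by omega) (measurable_stripStep hf)]
    set n := s + k with hn
    set S := D ∩ excursion 𝒢 F e A s i n with hS
    set g : (ℝ × Fin L) × ℝ≥0∞ → (∀ k, 𝒳 k) → ℝ≥0∞ := fun z x =>
      z.2 * (Set.Ioo 0 A).indicator f (step 𝒢 F e x z.1).1 with hg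
    have hgm : Measurable (Function.uncurry g) := by
      have hs : Measurable fun p : ((ℝ × Fin L) × ℝ≥0∞) × (∀ k, 𝒳 k) => step 𝒢 F e p.2 p.1.1 :=
        measurable_step.comp (by fun_prop :
          Measurable fun p : ((ℝ × Fin L) × ℝ≥0∞) × (∀ k, 𝒳 k) => (p.1.1, p.2))
      exact measurable_fst.snd.mul ((hf.indicator measurableSet_Ioo).comp hs.fst)
    have hZ : Measurable[past 𝒳 n] fun ω =>
        (state 𝒢 F e ω n, S.indicator (1 : (ℕ → ∀ k, 𝒳 k) → ℝ≥0∞) ω) :=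
      (measurable_state_past n).prodMk (measurable_const.indicator (hR k))
    have key := lintegral_changeLaw_past (F := F) (G := G) (ν := ν) hZ hgm
    rw [if_pos (by omega)] at key
    rw [← lintegral_indicator (hRm (k + 1)), ← lintegral_indicator (hRm k)]
    refine Eq.trans (lintegral_congr fun ω => ?_) (key.trans (lintegral_congr fun ω => ?_))
    · have hmem : ω ∈ D ∩ excursion 𝒢 F e A s i (s + (k + 1)) ↔
          ω ∈ S ∧ (state 𝒢 F e ω (n + 1)).1 ∈ Set.Ioo 0 A := by
        rw [Set.mem_inter_iff, hS, Set.mem_inter_iff, and_assoc]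
        exact and_congr_right fun _ => mem_excursion_succ (Nat.le_add_right s k)
      by_cases hω : ω ∈ S
      · by_cases hlt : (state 𝒢 F e ω (n + 1)).1 ∈ Set.Ioo 0 A
        · rw [Set.indicator_of_mem (hmem.2 ⟨hω, hlt⟩)]
          simp only [hg, Set.indicator_of_mem hω, Pi.one_apply, one_mul]
          refine Eq.trans ?_ (Set.indicator_of_mem hlt f).symm
          exact congrArg f (max_eq_left hlt.1.le)
        · rw [Set.indicator_of_notMem fun h' => hlt (hmem.1 h').2]
          exact ((congrArg _ (Set.indicator_of_notMem hlt f)).trans (mul_zero _)).symm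
      · rw [Set.indicator_of_notMem fun h' => hω (hmem.1 h').1]
        simp [hg, Set.indicator_of_notMem hω]
    · by_cases hω : ω ∈ S
      · have hi := state_snd_of_mem_excursion hω.2 (Nat.le_add_right s k) le_rfl
        have hω' : ω ∈ D ∩ excursion 𝒢 F e A s i (s + k) := hω
        simp only [hg, Set.indicator_of_mem hω, Set.indicator_of_mem hω', Pi.one_apply, one_mul]
        rw [stripStep, ← hi, ← lintegral_xiLaw]
        · rfl
        · exact (hf.indicator measurableSet_Ioo).comp (measurable_const.add measurable_id)
      · have hω' : ω ∉ D ∩ excursion 𝒢 F e A s i (s + k) := hω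
        simp [hg, Set.indicator_of_notMem hω, Set.indicator_of_notMem hω']

/-- During an excursion of an unaffected unit the history records nothing new. -/
lemma exists_past_inter_excursion (hi : (e i).1 ∉ affected m F G) {B : Set (ℕ → ∀ k, 𝒳 k)}
    (hB : MeasurableSet[history m F G (rule 𝒢 F e) ν] B) :
    ∃ D : Set (ℕ → ∀ k, 𝒳 k), MeasurableSet[past 𝒳 s] D ∧
      B ∩ excursion 𝒢 F e A s i ν = D ∩ excursion 𝒢 F e A s i ν := by
  refine MeasurableSpace.generateFrom_induction _ (fun B _ => ∃ D : Set (ℕ → ∀ k, 𝒳 k), MeasurableSet[past 𝒳 s] D ∧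
      B ∩ excursion 𝒢 F e A s i ν = D ∩ excursion 𝒢 F e A s i ν) ?_ ?_ ?_ ?_ B hB
  · rintro _ ⟨t, htν, E, hE, C, hC, rfl⟩ -
    rcases lt_or_ge t s with hts | hst
    · refine ⟨_, ?_, rfl⟩
      have h1 : Measurable[past 𝒳 s] fun ω => (state 𝒢 F e ω t).2 :=
        measurable_snd.comp ((measurable_state_past t).mono (past_mono hts.le) le_rfl)
      have h2 : Measurable[past 𝒳 s] fun ω : ℕ → ∀ k, 𝒳 k => E.restrict (ω t) :=
        (measurable_restrict_finset E).comp (measurable_eval_past hts)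
      exact (h1 (MeasurableSet.of_discrete (s := {j | (e j).1 = E}))).inter (h2 hC)
    -- From time `s` on the excursion samples only the unaffected unit at `i`, so a generator asking
    -- for an affected unit at such a time does not meet it.
    · refine ⟨∅, @MeasurableSet.empty _ (past 𝒳 s), ?_⟩
      rw [Set.empty_inter]
      ext ω
      simp only [Set.mem_inter_iff, Set.mem_ofPred_eq, Set.mem_empty_iff_false, iff_false]
      rintro ⟨⟨hr, -⟩, hω⟩
      apply hi
      rw [← state_snd_of_mem_excursion hω hst htν.le]
      rw [← hr] at hE
      exact hE
  · exact ⟨∅, @MeasurableSet.empty _ (past 𝒳 s), rfl⟩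
  · rintro B - ⟨D, hD, h⟩
    refine ⟨Dᶜ, hD.compl, ?_⟩
    rw [Set.inter_comm, ← Set.sdiff_eq, ← Set.sdiff_inter_self_eq_sdiff, h, Set.sdiff_inter_self_eq_sdiff,
      Set.sdiff_eq, Set.inter_comm]
  · rintro B - h
    choose D hD h using h
    exact ⟨⋃ n, D n, MeasurableSet.iUnion hD, by simp only [Set.iUnion_inter, h]⟩

/-- On the excursion the history event can be replaced by one from the past of `s`. The mean of the
statistic and the probability of the event then share the factor given by the start of the
excursion, and only the killed walk matters. -/
lemma lintegral_history_inter_excursion_le (hi : (e i).1 ∉ affected m F G) (hsν : s ≤ ν)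
    {c : ℝ≥0∞}
    (hc : ∀ n, (stripStep (xiLaw 𝒢 F F (e i).1) A)^[n] ENNReal.ofReal 0 ≤
      c * (stripStep (xiLaw 𝒢 F F (e i).1) A)^[n] (fun _ => 1) 0) {B : Set (ℕ → ∀ k, 𝒳 k)}
    (hB : MeasurableSet[history m F G (rule 𝒢 F e) ν] B) :
    ∫⁻ ω in B ∩ excursion 𝒢 F e A s i ν, ENNReal.ofReal (max (state 𝒢 F e ω ν).1 0)
      ∂(changeLaw F G ν) ≤ c * changeLaw F G ν (B ∩ excursion 𝒢 F e A s i ν) := by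
  obtain ⟨D, hD, h⟩ := exists_past_inter_excursion (A := A) (s := s) hi hB
  obtain ⟨k, rfl⟩ := Nat.exists_eq_add_of_le hsν
  have hone := lintegral_excursion (𝒢 := 𝒢) (F := F) (G := G) (e := e) (A := A) (i := i) hD k le_rfl
    (f := fun _ => 1) measurable_const
  rw [setLIntegral_one] at hone
  rw [h, lintegral_excursion hD k le_rfl ENNReal.measurable_ofReal, hone, ← mul_assoc]
  gcongr
  exact hc k

/-- The last non-positive time and the unit taken up then partition the event, and the constant `c`
is the same for all pieces; uniformity in the length of the excursion is essential here. -/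
lemma lintegral_history_unaffected_le {c : ℝ≥0∞}
    (hc : ∀ i, (e i).1 ∉ affected m F G → ∀ n,
      (stripStep (xiLaw 𝒢 F F (e i).1) A)^[n] ENNReal.ofReal 0 ≤
      c * (stripStep (xiLaw 𝒢 F F (e i).1) A)^[n] (fun _ => 1) 0) {B : Set (ℕ → ∀ k, 𝒳 k)}
    (hB : MeasurableSet[history m F G (rule 𝒢 F e) ν] B) (hBm : MeasurableSet B) :
    ∫⁻ ω in B ∩ {ω | (ν : ℕ∞) < alarm 𝒢 F e A ω ∧ (e (state 𝒢 F e ω ν).2).1 ∉ affected m F G},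
      ENNReal.ofReal (max (state 𝒢 F e ω ν).1 0) ∂(changeLaw F G ν) ≤
      c * changeLaw F G ν (B ∩ {ω | (ν : ℕ∞) < alarm 𝒢 F e A ω}) := by
  classical
  let ι := Fin (ν + 1) × {i : Fin L // (e i).1 ∉ affected m F G}
  set R : ι → Set (ℕ → ∀ k, 𝒳 k) := fun p => B ∩ excursion 𝒢 F e A p.1 p.2 ν with hR
  have hcover : B ∩ {ω | (ν : ℕ∞) < alarm 𝒢 F e A ω ∧
      (e (state 𝒢 F e ω ν).2).1 ∉ affected m F G} ⊆ ⋃ p, R p := by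
    rintro ω ⟨hω, hlt, hna⟩
    obtain ⟨s, hs, hmem⟩ := exists_mem_excursion hlt
    exact Set.mem_iUnion.2 ⟨(⟨s, by omega⟩, ⟨_, hna⟩), hω, hmem⟩
  have hdisj : Pairwise (Function.onFun Disjoint R) := by
    have hlt : ∀ p q : ι, p.1.val < q.1.val → ∀ ω, ω ∈ R p → ω ∉ R q := fun p q hpq ω hp hq =>
      (hp.2.2.2.2 q.1 hpq (by omega)).1.not_ge hq.2.2.2.1
    rintro p q hpq
    rw [Function.onFun, Set.disjoint_left]
    intro ω hp hq
    rcases lt_trichotomy p.1.val q.1.val with h | h | h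
    · exact hlt p q h ω hp hq
    · apply hpq
      have h2 := hp.2.2.1
      rw [h] at h2
      exact Prod.ext (Fin.ext h) (Subtype.ext (h2.symm.trans hq.2.2.1))
    · exact hlt q p h ω hq hp
  have hmeas : ∀ p, MeasurableSet (R p) := fun p =>
    hBm.inter (past_le ν _ (measurableSet_excursion (Nat.lt_succ_iff.1 p.1.2)))
  calc _ ≤ ∫⁻ ω in ⋃ p, R p, ENNReal.ofReal (max (state 𝒢 F e ω ν).1 0) ∂(changeLaw F G ν) :=
        lintegral_mono_set hcover
    _ ≤ ∑' p, ∫⁻ ω in R p, ENNReal.ofReal (max (state 𝒢 F e ω ν).1 0) ∂(changeLaw F G ν) :=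
        lintegral_iUnion_le _ _
    _ ≤ ∑' p, c * changeLaw F G ν (R p) := ENNReal.tsum_le_tsum fun p =>
        lintegral_history_inter_excursion_le p.2.2 (Nat.lt_succ_iff.1 p.1.2) (hc p.2.1 p.2.2) hB
    _ = c * changeLaw F G ν (⋃ p, R p) := by
        rw [ENNReal.tsum_mul_left, measure_iUnion hdisj hmeas]
    _ ≤ _ := by
        gcongr
        exact Set.iUnion_subset fun p => Set.inter_subset_inter_right _ fun ω hω =>
          lt_alarm_of_mem_excursion hω

/-- The delay bound in terms of the two ingredients: a supersolution for the time to alarm and the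
conditional mean of the statistic during excursions of unaffected units. -/
theorem worstDelay_le {h : ℝ → Fin L → ℝ} {M C ε : ℝ} (hA : 0 < A) (hM : 0 ≤ M) (hC : 0 ≤ C)
    (hε : 0 ≤ ε) (hmeas : ∀ i, Measurable fun y => h y i)
    (hstep : ∀ i, ∀ y < A, 1 + ∫⁻ x, (if max y 0 + x < A then ENNReal.ofReal (h (max y 0 + x)
      (if max y 0 + x ≤ 0 then i + 1 else i)) else 0) ∂(xiLaw 𝒢 F G (e i).1) ≤
        ENNReal.ofReal (h y i))
    (haff : ∀ i y, (e i).1 ∈ affected m F G → h y i ≤ M)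
    (hun : ∀ i y, (e i).1 ∉ affected m F G → h y i ≤ M + C * max y 0)
    (hc : ∀ i, (e i).1 ∉ affected m F G → ∀ n,
      (stripStep (xiLaw 𝒢 F F (e i).1) A)^[n] ENNReal.ofReal 0 ≤
        ENNReal.ofReal ε * (stripStep (xiLaw 𝒢 F F (e i).1) A)^[n] (fun _ => 1) 0) :
    worstDelay m F G (rule 𝒢 F e) (alarm 𝒢 F e A) ≤ ENNReal.ofReal (M + C * ε) := by
  classical
  refine iSup_le fun ν => essSup_le_of_ae_le _ ?_
  by_cases hm : history m F G (rule 𝒢 F e) ν ≤ MeasurableSpace.pi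
  swap
  · rw [condLExp_of_not_le hm]
    exact .of_forall fun _ => zero_le
  set S := {ω : ℕ → ∀ k, 𝒳 k | (ν : ℕ∞) < alarm 𝒢 F e A ω} with hS
  have hSm : MeasurableSet S := past_le ν _ (measurableSet_lt_alarm ν)
  have hhist : history m F G (rule 𝒢 F e) ν ≤ past 𝒳 ν := by
    refine MeasurableSpace.generateFrom_le ?_
    rintro _ ⟨t, htν, E, hE, D, hD, rfl⟩
    have h1 : Measurable[past 𝒳 ν] fun ω => (state 𝒢 F e ω t).2 :=
      measurable_snd.comp ((measurable_state_past t).mono (past_mono htν.le) le_rfl)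
    have h2 : Measurable[past 𝒳 ν] fun ω : ℕ → ∀ k, 𝒳 k => E.restrict (ω t) :=
      (measurable_restrict_finset E).comp (measurable_eval_past htν)
    exact (h1 (MeasurableSet.of_discrete (s := {j | (e j).1 = E}))).inter (h2 hD)
  refine ae_le_of_ae_le_trim (hm := hm) ?_
  -- The essential supremum is bounded by testing on history events `B`; the normalization by the
  -- probability of no alarm cancels on both sides.
  refine ae_le_of_forall_setLIntegral_le_of_sigmaFinite (measurable_condLExp _ _ _)
    fun B hB _ => ?_
  rw [setLIntegral_condLExp_trim hm _ _ hB, setLIntegral_const, trim_measurableSet_eq hm hB]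
  have hBm : MeasurableSet B := hm B hB
  rw [ProbabilityTheory.cond, Measure.restrict_smul, lintegral_smul_measure, Measure.smul_apply,
    Measure.restrict_restrict hBm, Measure.restrict_apply hBm, smul_eq_mul, smul_eq_mul,
    mul_left_comm]
  refine mul_le_mul_right ?_ _
  have hmain := lintegral_alarm_sub_le (ν := ν) (e := e) hA hmeas hstep
    (((hhist B hB).inter (measurableSet_lt_alarm ν)) : MeasurableSet[past 𝒳 ν] (B ∩ S))
  rw [Set.inter_assoc, Set.inter_self] at hmain
  refine hmain.trans ?_
  set V := {ω : ℕ → ∀ k, 𝒳 k | (ν : ℕ∞) < alarm 𝒢 F e A ω ∧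
    (e (state 𝒢 F e ω ν).2).1 ∉ affected m F G} with hV
  have hVm : MeasurableSet V := by
    have h1 : Measurable fun ω => (state 𝒢 F e ω ν).2 :=
      measurable_snd.comp ((measurable_state_past ν).mono (past_le ν) le_rfl)
    exact hSm.inter (h1 (MeasurableSet.of_discrete (s := {j | (e j).1 ∉ affected m F G})))
  have hBS : MeasurableSet (B ∩ S) := hBm.inter hSm
  have hBV : MeasurableSet (B ∩ V) := hBm.inter hVm
  calc ∫⁻ ω in B ∩ S, ENNReal.ofReal (h (state 𝒢 F e ω ν).1 (state 𝒢 F e ω ν).2)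
        ∂(changeLaw F G ν)
      ≤ ∫⁻ ω in B ∩ S, (ENNReal.ofReal M + (B ∩ V).indicator
          (fun ω => ENNReal.ofReal C * ENNReal.ofReal (max (state 𝒢 F e ω ν).1 0)) ω)
          ∂(changeLaw F G ν) := by
        refine setLIntegral_mono' hBS fun ω hω => ?_
        by_cases ha : (e (state 𝒢 F e ω ν).2).1 ∈ affected m F G
        · exact (ENNReal.ofReal_le_ofReal (haff _ _ ha)).trans le_self_add
        · rw [Set.indicator_of_mem (show ω ∈ B ∩ V from ⟨hω.1, hω.2, ha⟩),
            ← ENNReal.ofReal_mul hC, ← ENNReal.ofReal_add hM (mul_nonneg hC (le_max_right _ _))]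
          exact ENNReal.ofReal_le_ofReal (hun _ _ ha)
    _ ≤ ENNReal.ofReal M * changeLaw F G ν (B ∩ S) + ENNReal.ofReal C *
          ∫⁻ ω in B ∩ V, ENNReal.ofReal (max (state 𝒢 F e ω ν).1 0) ∂(changeLaw F G ν) := by
        rw [lintegral_add_left measurable_const, setLIntegral_const,
          ← lintegral_const_mul' _ _ ENNReal.ofReal_ne_top]
        refine add_le_add le_rfl ((setLIntegral_le_lintegral _ _).trans ?_)
        rw [lintegral_indicator hBV]
    _ ≤ ENNReal.ofReal M * changeLaw F G ν (B ∩ S) + ENNReal.ofReal C *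
          (ENNReal.ofReal ε * changeLaw F G ν (B ∩ S)) := by
        gcongr
        exact lintegral_history_unaffected_le hc hB hBm
    _ = ENNReal.ofReal (M + C * ε) * changeLaw F G ν (S ∩ B) := by
        rw [Set.inter_comm S B, ENNReal.ofReal_add hM (mul_nonneg hC hε), ENNReal.ofReal_mul hC]
        ring
    _ = _ := by rw [Set.inter_comm]

end Excursion

end RoundRobin

/-! ### Assembly and the choice of constants -/

theorem theorem3 {K : ℕ} {𝒳 : Fin K → Type*} [∀ k, MeasurableSpace (𝒳 k)] (m : ℕ)
    (F : ProbabilityMeasure (∀ k, 𝒳 k)) (𝒢 : Set (ProbabilityMeasure (∀ k, 𝒳 k)))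
    (hac : ∀ P ∈ 𝒢, ∀ E ∈ affected m F P,
      localLaw P E ≪ localLaw F E ∧ localLaw F E ≪ localLaw P E)
    (U : Finset (Finset (Fin K))) (hU : U ⊆ Finset.powersetCard m Finset.univ)
    (hfam : ∀ E ∈ U, (localFamily 𝒢 F E).Nonempty ∧ (localFamily 𝒢 F E).Finite)
    {L : ℕ} [NeZero L] (e : Fin L ≃ U)
    (G : ProbabilityMeasure (∀ k, 𝒳 k)) (hG : G ∈ 𝒢)
    (hne : (affected m F G ∩ U).Nonempty)
    (hpre : ∀ E ∈ U, Integrable (llr (localLaw F E) (mixture 𝒢 F E)) (localLaw F E) ∧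
      0 < driftPre 𝒢 F E)
    (hpost : ∀ E ∈ affected m F G ∩ U, Integrable (xi 𝒢 F E) (localLaw G E) ∧
      0 < driftPost 𝒢 F G E) :
    ∃ r : ℝ → ℝ, r =o[atTop] (fun A : ℝ => A) ∧
      ∀ᶠ A : ℝ in atTop,
        worstDelay m F G (rule 𝒢 F e) (alarm 𝒢 F e A) ≤
          ENNReal.ofReal
            ((affected m F G ∩ U).sup' hne (fun E => A / driftPost 𝒢 F G E) + r A) := by
  classical
  have hmemU : ∀ i, (e i).1 ∈ U := fun i => (e i).2
  have hint_pre : ∀ i, Integrable (fun x => x) (xiLaw 𝒢 F F (e i).1) ∧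
      ∫ x, x ∂(xiLaw 𝒢 F F (e i).1) < 0 := fun i =>
    integral_xiLaw_pre_neg hac (hU (hmemU i)) (hfam _ (hmemU i)).1 (hfam _ (hmemU i)).2
      (hpre _ (hmemU i))
  have hexp_pre : ∀ i, Integrable Real.exp (xiLaw 𝒢 F F (e i).1) ∧
      ∫ x, Real.exp x ∂(xiLaw 𝒢 F F (e i).1) = 1 := fun i =>
    integral_exp_xiLaw_pre hac (hU (hmemU i)) (hfam _ (hmemU i)).1 (hfam _ (hmemU i)).2
  have hlaw : ∀ i, (e i).1 ∉ affected m F G → xiLaw 𝒢 F G (e i).1 = xiLaw 𝒢 F F (e i).1 :=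
    fun i hi => xiLaw_eq_of_localLaw_eq (localLaw_eq_of_notMem_affected (hU (hmemU i)) hi)
  have hmem : ∀ i, (e i).1 ∈ affected m F G → (e i).1 ∈ affected m F G ∩ U := fun i hi =>
    Finset.mem_inter.2 ⟨hi, hmemU i⟩
  have hpost' : ∀ i, (e i).1 ∈ affected m F G → Integrable (fun x => x) (xiLaw 𝒢 F G (e i).1) ∧
      ∫ x, x ∂(xiLaw 𝒢 F G (e i).1) = driftPost 𝒢 F G (e i).1 := fun i hi =>
    integral_xiLaw_post (hpost _ (hmem i hi)).1
  obtain ⟨E₀, hE₀, hmin⟩ := Finset.exists_min_image _ (driftPost 𝒢 F G) hne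
  set J₀ := driftPost 𝒢 F G E₀ with hJ₀
  have hJ₀pos : 0 < J₀ := (hpost E₀ hE₀).2
  obtain ⟨C₂, hC₂, hsol⟩ := exists_time_supersolution
    (p := fun i => (e i).1 ∈ affected m F G)
    ⟨e.symm ⟨E₀, (Finset.mem_inter.1 hE₀).2⟩, by simpa using (Finset.mem_inter.1 hE₀).1⟩
    (fun i => xiLaw 𝒢 F G (e i).1)
    (fun i => by
      by_cases hi : (e i).1 ∈ affected m F G
      · exact (hpost' i hi).1
      · rw [hlaw i hi]; exact (hint_pre i).1)
    (fun i hi => by rw [(hpost' i hi).2]; exact (hpost _ (hmem i hi)).2)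
    (fun i hi => integrable_exp_neg_xiLaw_post hac (hU (hmemU i)) (hfam _ (hmemU i)).2
      (localLaw_mem_localFamily hG hi))
    (fun i hi => by rw [hlaw i hi]; exact (hint_pre i).2)
  have hbound : ∀ ε > 0, ∀ᶠ A : ℝ in atTop,
      worstDelay m F G (rule 𝒢 F e) (alarm 𝒢 F e A) ≤ ENNReal.ofReal (A / J₀ + ε * A) := by
    intro ε hε
    -- This drift lies strictly below the smallest affected drift `J₀` and gives A/J = A/J₀ + εA/3.
    -- The other two thirds of `ε` go to `C₁` and to the conditional mean of the statistic.
    set J := 1 / (1 / J₀ + ε / 3) with hJ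
    have hJpos : 0 < J := by positivity
    have hJlt : J < J₀ := by
      rw [hJ, div_lt_iff₀ (by positivity), mul_add, mul_one_div_cancel hJ₀pos.ne']
      have : 0 < J₀ * (ε / 3) := by positivity
      linarith
    have hAJ : ∀ A, A / J = A / J₀ + ε / 3 * A := fun A => by
      rw [hJ, div_div_eq_mul_div, div_one]; ring
    obtain ⟨C₁, hC₁⟩ := hsol J hJpos fun i hi => by
      rw [(hpost' i hi).2]
      exact hJlt.trans_le (hmin _ (hmem i hi))
    set δ := ε / (3 * (C₂ + 1)) with hδ
    have hδpos : 0 < δ := by positivity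
    have hδC : C₂ * δ ≤ ε / 3 := by
      calc C₂ * δ ≤ (C₂ + 1) * δ := by gcongr; linarith
        _ = ε / 3 := by rw [hδ]; field_simp
    choose A₁ hA₁ using fun i =>
      stripStep_iterate_ofReal_le (hexp_pre i).1 (hexp_pre i).2 (hint_pre i).2 hδpos
    obtain ⟨A₂, hA₂⟩ := Finite.exists_le A₁
    filter_upwards [eventually_gt_atTop 0, eventually_ge_atTop A₂,
      eventually_ge_atTop (|C₁| * J), eventually_ge_atTop (C₁ / (ε / 3))] with A hA h2 h3 h4
    obtain ⟨h, hmeas, hstep, haff, hun⟩ := hC₁ A hA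
    have hM : 0 ≤ A / J + C₁ := by
      have : |C₁| ≤ A / J := by rwa [le_div_iff₀ hJpos]
      linarith [neg_abs_le C₁]
    refine (worstDelay_le hA hM hC₂ (by positivity : 0 ≤ δ * A) hmeas hstep
      (fun i y hi => haff i y hi) (fun i y hi => hun i y hi)
      (fun i _ => hA₁ i A ((hA₂ i).trans h2))).trans (ENNReal.ofReal_le_ofReal ?_)
    rw [div_le_iff₀ (by positivity)] at h4
    have h5 : C₂ * (δ * A) ≤ ε / 3 * A := by
      rw [← mul_assoc]; gcongr
    rw [hAJ]
    linarith
  have hsup : ∀ A : ℝ, A / J₀ ≤ (affected m F G ∩ U).sup' hne fun E => A / driftPost 𝒢 F G E :=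
    fun A => Finset.le_sup' (fun E => A / driftPost 𝒢 F G E) hE₀
  -- The remainder is the positive part of the actual excess over the main term, so one function
  -- serves every `ε` at once. The delay is eventually finite, hence `toReal` loses nothing.
  refine ⟨fun A => max 0 ((worstDelay m F G (rule 𝒢 F e) (alarm 𝒢 F e A)).toReal -
    (affected m F G ∩ U).sup' hne fun E => A / driftPost 𝒢 F G E), ?_, ?_⟩
  · refine isLittleO_iff.2 fun c hc => ?_
    filter_upwards [hbound c hc, eventually_gt_atTop 0] with A hA hApos
    have h1 := ENNReal.toReal_le_of_le_ofReal (by positivity) hA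
    rw [Real.norm_eq_abs, Real.norm_eq_abs, abs_of_nonneg (le_max_left _ _), abs_of_pos hApos]
    exact max_le (by positivity) (by linarith [hsup A])
  · filter_upwards [hbound 1 one_pos] with A hA
    have hfin := ne_top_of_le_ne_top ENNReal.ofReal_ne_top hA
    rw [← ENNReal.ofReal_toReal hfin]
    refine ENNReal.ofReal_le_ofReal ?_
    rw [ENNReal.ofReal_toReal hfin, ← sub_le_iff_le_add']
    exact le_max_right _ _
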